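/- Let $n\ge 0$ and let $S_n$ be the symmetric group with simple reflections $s_i=(i\ \ i+1)$, $1\le i\le n-1$, and length function $\ell$. Let $\mathcal H$ be the Iwahori--Hecke algebra of $S_n$ over $\mathbb Z[\xi]$ ($\xi$ an indeterminate), that is, the associative unital $\mathbb Z[\xi]$-algebra generated by $\tilde T_{s_1},\dots,\tilde T_{s_{n-1}}$ subject to $\tilde T_{s_i}\tilde T_{s_j}=\tilde T_{s_j}\tilde T_{s_i}$ for $|i-j|\ge 2$, $\tilde T_{s_i}\tilde T_{s_{i+1}}\tilde T_{s_i}=\tilde T_{s_{i+1}}\tilde T_{s_i}\tilde T_{s_{i+1}}$ for $1\le i\le n-2$, and $\tilde T_{s_i}^2=1+\xi\tilde T_{s_i}$ for $1\le i\le n-1$. For $w\in S_n$ with reduced expression $w=s_{i_1}\cdots s_{i_r}$ put $\tilde T_w=\tilde T_{s_{i_1}}\cdots\tilde T_{s_{i_r}}$. For a composition $\lambda=(\lambda_1,\dots,\lambda_r)$ of $n$ (a finite sequence of positive integers with sum $n$), let $S_\lambda=S_{\lambda_1}\times\cdots\times S_{\lambda_r}\le S_n$ be the parabolic subgroup generated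 by the $s_j$ with $j\notin\{\lambda_1,\lambda_1+\lambda_2,\dots,\lambda_1+\cdots+\lambda_{r-1}\}$, let $w_\lambda$ be the product of these $s_j$ in increasing order of $j$, and let $\lambda-1$ be the composition of $n$ obtained from $\lambda$ by replacing each component $\lambda_i>1$ by the two consecutive components $\lambda_i-1,\,1$. For parabolic subgroups $H\le K$ of $S_n$ and $h\in\mathcal H$ define the relative norm \[\mathcal N_{K,H}(h)=\sum_{d\in\mathcal D}\tilde T_{d^{-1}}\,h\,\tilde T_d,\] where $\mathcal D$ is the set of distinguished right coset representatives of $H$ in $K$, i.e. of the $d\in K$ that have minimal length in the coset $Hd$. Put \[\eta_\lambda=\mathcal N_{S_{\lambda-1},1}(\tilde T_{w_\lambda}),\qquad b_\lambda=\mathcal N_{S_n,S_\lambda}(\eta_\lambda).\] If $\alpha$ and $\beta$ are conjugate compositions of $n$, i.e. they have the same components, counted with multiplicity, possibly in a different order, then $b_\alpha=b_\beta$. -/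

import Mathlib

open Polynomial

namespace HeckeNorm

/-! ### The symmetric group -/

/-- The simple reflections of `S_n`, as permutations of `{0, …, n-1}`.
The index `i : Fin (n - 1)` is the usual index minus one: `simpleRefl i` exchanges `i` and `i + 1`. -/
def simpleRefl {n : ℕ} (i : Fin (n - 1)) : Equiv.Perm (Fin n) :=
  Equiv.swap ⟨i, by omega⟩ ⟨i + 1, by omega⟩

/-- The element of `S_n` expressed by a word in the simple reflections. -/
def wordProd {n : ℕ} (l : List (Fin (n - 1))) : Equiv.Perm (Fin n) :=
  (l.map simpleRefl).prod

/-- The simple reflections generate `S_n`. -/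
theorem exists_word {n : ℕ} (w : Equiv.Perm (Fin n)) : ∃ l : List (Fin (n - 1)), wordProd l = w := by
  cases n with
  | zero => exact ⟨[], Subsingleton.elim _ _⟩
  | succ m =>
    have hw : w ∈ Submonoid.closure
        (Set.range fun i : Fin m => Equiv.swap i.castSucc i.succ) := by
      rw [Equiv.Perm.mclosure_swap_castSucc_succ]; trivial
    induction hw using Submonoid.closure_induction with
    | mem x hx =>
      obtain ⟨i, rfl⟩ := hx
      exact ⟨[i], by simp [wordProd, simpleRefl]; rfl⟩
    | one => exact ⟨[], rfl⟩
    | mul x y _ _ hx hy =>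
      obtain ⟨l, rfl⟩ := hx
      obtain ⟨k, rfl⟩ := hy
      exact ⟨l ++ k, by simp [wordProd]⟩

/-- The length of `w`: the least number of simple reflections in an expression for `w`. -/
noncomputable def length {n : ℕ} (w : Equiv.Perm (Fin n)) : ℕ :=
  sInf {k | ∃ l : List (Fin (n - 1)), l.length = k ∧ wordProd l = w}

/-- `l` is a reduced expression for `w`. -/
def IsReducedWord {n : ℕ} (l : List (Fin (n - 1))) (w : Equiv.Perm (Fin n)) : Prop :=
  wordProd l = w ∧ l.length = length w

theorem exists_reducedWord {n : ℕ} (w : Equiv.Perm (Fin n)) :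
    ∃ l : List (Fin (n - 1)), IsReducedWord l w := by
  obtain ⟨l, hl⟩ := exists_word w
  obtain ⟨k, hk, hw⟩ := Nat.sInf_mem
    (s := {k | ∃ l : List (Fin (n - 1)), l.length = k ∧ wordProd l = w}) ⟨l.length, l, rfl, hl⟩
  exact ⟨k, hw, hk⟩

/-- `simpleRefl j` is one of the simple reflections generating the parabolic subgroup of `c`:
`j` and `j + 1` are positions inside one block of `c`. -/
def IsSimpleOf {n : ℕ} (c : Composition n) (j : Fin (n - 1)) : Prop :=
  ∃ i < c.length, c.sizeUpTo i ≤ (j : ℕ) ∧ (j : ℕ) + 1 < c.sizeUpTo (i + 1)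

/-- The parabolic (Young) subgroup `S_c` of `S_n`. -/
def parabolic {n : ℕ} (c : Composition n) : Subgroup (Equiv.Perm (Fin n)) :=
  Subgroup.closure (simpleRefl '' {j | IsSimpleOf c j})

open Classical in
/-- The Coxeter element `w_c` of `S_c`: the product, in increasing order of index, of the simple
reflections that generate `S_c`. -/
noncomputable def coxeterElt {n : ℕ} (c : Composition n) : Equiv.Perm (Fin n) :=
  wordProd ((List.finRange (n - 1)).filter fun j => IsSimpleOf c j)

/-- The replacement of a single component: `k > 1` becomes `k - 1, 1`, and `1` stays. -/
def splitOne (k : ℕ) : List ℕ := if 1 < k then [k - 1, 1] else [k]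

/-- The composition `c - 1` of `n`: every component `k > 1` is replaced by `k - 1, 1`. -/
def subOne {n : ℕ} (c : Composition n) : Composition n where
  blocks := c.blocks.flatMap splitOne
  blocks_pos := by
    intro i hi
    obtain ⟨k, hk, hik⟩ := List.mem_flatMap.1 hi
    have := c.blocks_pos hk
    unfold splitOne at hik
    split_ifs at hik <;> simp at hik <;> omega
  blocks_sum := by
    have h : ∀ l : List ℕ, (l.flatMap splitOne).sum = l.sum := by
      intro l
      induction l with
      | nil => rfl
      | cons k l ih =>
        rw [List.flatMap_cons, List.sum_append, ih, List.sum_cons]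
        congr 1
        unfold splitOne
        split_ifs
        · simp; omega
        · simp
    rw [h, c.blocks_sum]

/-- Two compositions are conjugate if they have the same components, with multiplicity. -/
def Conjugate {n : ℕ} (α β : Composition n) : Prop := α.blocks.Perm β.blocks

open Classical in
/-- The distinguished right coset representatives of `H` in `K`: the elements `d` of `K`
of minimal length in their coset `H d`. -/
noncomputable def rightReps {n : ℕ} (K H : Subgroup (Equiv.Perm (Fin n))) :
    Finset (Equiv.Perm (Fin n)) :=
  Finset.univ.filter fun d => d ∈ K ∧ ∀ u ∈ H, length d ≤ length (u * d)

/-! ### The Hecke algebra -/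

/-- The defining relations of the Iwahori–Hecke algebra of `S_n` over `ℤ[ξ]`; the indeterminate
`ξ` is `X : ℤ[X]`. -/
inductive HeckeRel (n : ℕ) :
    FreeAlgebra ℤ[X] (Fin (n - 1)) → FreeAlgebra ℤ[X] (Fin (n - 1)) → Prop
  | comm (i j : Fin (n - 1)) (h : (i : ℕ) + 2 ≤ j) :
      HeckeRel n (FreeAlgebra.ι ℤ[X] i * FreeAlgebra.ι ℤ[X] j)
        (FreeAlgebra.ι ℤ[X] j * FreeAlgebra.ι ℤ[X] i)
  | braid (i j : Fin (n - 1)) (h : (i : ℕ) + 1 = j) :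
      HeckeRel n (FreeAlgebra.ι ℤ[X] i * FreeAlgebra.ι ℤ[X] j * FreeAlgebra.ι ℤ[X] i)
        (FreeAlgebra.ι ℤ[X] j * FreeAlgebra.ι ℤ[X] i * FreeAlgebra.ι ℤ[X] j)
  | quad (i : Fin (n - 1)) :
      HeckeRel n (FreeAlgebra.ι ℤ[X] i * FreeAlgebra.ι ℤ[X] i)
        (1 + (X : ℤ[X]) • FreeAlgebra.ι ℤ[X] i)

/-- The Iwahori–Hecke algebra of `S_n` over `ℤ[ξ]`, with normalized generators. -/
abbrev Hecke (n : ℕ) : Type := RingQuot (HeckeRel n)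

/-- The normalized generator of the Hecke algebra attached to `simpleRefl i`. -/
noncomputable def gen {n : ℕ} (i : Fin (n - 1)) : Hecke n :=
  RingQuot.mkAlgHom ℤ[X] (HeckeRel n) (FreeAlgebra.ι ℤ[X] i)

/-- The standard basis element `T_w`: the product of the generators along a reduced expression
for `w` (by the braid relations the choice of the reduced expression is immaterial). -/
noncomputable def T {n : ℕ} (w : Equiv.Perm (Fin n)) : Hecke n :=
  ((exists_reducedWord w).choose.map gen).prod

/-! ### Norms -/

/-- The relative norm of `h` from `H` to `K`. -/
noncomputable def relNorm {n : ℕ} (K H : Subgroup (Equiv.Perm (Fin n))) (h : Hecke n) : Hecke n :=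
  ∑ d ∈ rightReps K H, T d⁻¹ * h * T d

/-- The Coxeter class element `η_c`. -/
noncomputable def eta {n : ℕ} (c : Composition n) : Hecke n :=
  relNorm (parabolic (subOne c)) ⊥ (T (coxeterElt c))

/-- The norm `b_α`. -/
noncomputable def b {n : ℕ} (α : Composition n) : Hecke n :=
  relNorm ⊤ (parabolic α) (eta α)

end HeckeNorm

/-! Let `J` be the set of (zero-based) indices of the simple reflections in `S_α`. The proof has
three ingredients.

Closed form of `eta`. Put `L_m = g_m + g_m L_{m-1} g_m` when `m - 1 ∈ J`, and `L_m = g_m` otherwise: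
these are multiplicative Jucys–Murphy elements, restarted at each block. Building the norm one
generator at a time gives `eta α = ∏ L_m` over `m ∈ J` (`youngNorm_orderedProd`). The factors
commute, and the product commutes with every generator indexed by `J`
(`IsHeckeFamily.commute_orderedProd_jucysMurphy`).

Intertwiner. For conjugate `α` and `β`, some permutation `σ` moves each block of `α` rigidly onto an
equal block of `β` (`exists_mapsSimple`). Then `σ⁻¹` is distinguished for `S_α` and `σ` for `S_β`,
so lengths add in `x σ⁻¹ = σ⁻¹ (σ x σ⁻¹)`, and the unit `t = T σ⁻¹` satisfies `T x * t = t * T (σ x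
σ⁻¹)` on `S_α`. Hence `t` carries each `L_m` of `α` to one of `β`, and `eta α * t = t * eta β`.

Invariance of the norm. For the symmetrizing trace the elements `T x * T d` and `T d⁻¹ * T x⁻¹` form
dual bases. So the sum of the `T d⁻¹ ⊗ T d` over the subalgebra is a Casimir element, which does not
change when the basis `T d` is replaced by the `t * T d'`. Applied to `h` commuting with the
subalgebra, this yields equal norms for `h` and `t⁻¹ h t` (`sum_distinguished_conj`). -/

namespace HeckeNorm

/-! ### Length and inversions -/

/-- The smaller of the two points moved by `simpleRefl i`. -/
def lo {n : ℕ} (i : Fin (n - 1)) : Fin n := ⟨i, by omega⟩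

/-- The larger of the two points moved by `simpleRefl i`. -/
def hi {n : ℕ} (i : Fin (n - 1)) : Fin n := ⟨i + 1, by omega⟩

@[simp] theorem lo_val {n : ℕ} (i : Fin (n - 1)) : (lo i : ℕ) = i := rfl

@[simp] theorem hi_val {n : ℕ} (i : Fin (n - 1)) : (hi i : ℕ) = i + 1 := rfl

theorem lo_ne_hi {n : ℕ} (i : Fin (n - 1)) : lo i ≠ hi i := by
  simp [Fin.ext_iff]

theorem simpleRefl_eq {n : ℕ} (i : Fin (n - 1)) : simpleRefl i = Equiv.swap (lo i) (hi i) := rfl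

@[simp] theorem simpleRefl_lo {n : ℕ} (i : Fin (n - 1)) : simpleRefl i (lo i) = hi i :=
  Equiv.swap_apply_left _ _

@[simp] theorem simpleRefl_hi {n : ℕ} (i : Fin (n - 1)) : simpleRefl i (hi i) = lo i :=
  Equiv.swap_apply_right _ _

theorem simpleRefl_of_ne {n : ℕ} {i : Fin (n - 1)} {a : Fin n} (h₁ : (a : ℕ) ≠ i)
    (h₂ : (a : ℕ) ≠ i + 1) : simpleRefl i a = a :=
  Equiv.swap_apply_of_ne_of_ne (fun h => h₁ (by rw [h])) (fun h => h₂ (by rw [h]))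

@[simp] theorem simpleRefl_mul_self {n : ℕ} (i : Fin (n - 1)) :
    simpleRefl i * simpleRefl i = 1 := Equiv.swap_mul_self _ _

@[simp] theorem simpleRefl_inv {n : ℕ} (i : Fin (n - 1)) : (simpleRefl i)⁻¹ = simpleRefl i :=
  Equiv.swap_inv _ _

@[simp] theorem simpleRefl_simpleRefl {n : ℕ} (i : Fin (n - 1)) (a : Fin n) :
    simpleRefl i (simpleRefl i a) = a := by
  rw [← Equiv.Perm.mul_apply, simpleRefl_mul_self, Equiv.Perm.one_apply]

@[simp] theorem simpleRefl_mul_cancel_left {n : ℕ} (i : Fin (n - 1)) (w : Equiv.Perm (Fin n)) :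
    simpleRefl i * (simpleRefl i * w) = w := by rw [← mul_assoc]; simp

@[simp] theorem mul_simpleRefl_cancel_right {n : ℕ} (i : Fin (n - 1)) (w : Equiv.Perm (Fin n)) :
    w * simpleRefl i * simpleRefl i = w := by rw [mul_assoc]; simp

theorem simpleRefl_val {n : ℕ} (i : Fin (n - 1)) (a : Fin n) :
    (simpleRefl i a : ℕ) = if (a : ℕ) = i then (i : ℕ) + 1 else if (a : ℕ) = i + 1 then i else a := by
  split_ifs with h₁ h₂
  · rw [show a = lo i from Fin.ext h₁]; simp
  · rw [show a = hi i from Fin.ext h₂]; simp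
  · rw [simpleRefl_of_ne h₁ h₂]

theorem simpleRefl_lt {n : ℕ} {i : Fin (n - 1)} {a b : Fin n} (h : a < b)
    (hne : ¬((a : ℕ) = i ∧ (b : ℕ) = i + 1)) : simpleRefl i a < simpleRefl i b := by
  rw [Fin.lt_def] at h ⊢
  rw [simpleRefl_val, simpleRefl_val]
  split_ifs <;> omega

theorem simpleRefl_comm {n : ℕ} {i j : Fin (n - 1)} (h : (i : ℕ) + 2 ≤ j) :
    simpleRefl i * simpleRefl j = simpleRefl j * simpleRefl i := by
  ext a
  simp only [Equiv.Perm.mul_apply, simpleRefl_val]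
  split_ifs <;> omega

theorem simpleRefl_braid {n : ℕ} {i j : Fin (n - 1)} (h : (i : ℕ) + 1 = j) :
    simpleRefl i * simpleRefl j * simpleRefl i = simpleRefl j * simpleRefl i * simpleRefl j := by
  have hb : hi i = lo j := Fin.ext (by simpa using h)
  have si : simpleRefl i (hi j) = hi j := simpleRefl_of_ne (by simp; omega) (by simp; omega)
  have sj : simpleRefl j (lo i) = lo i := simpleRefl_of_ne (by simp; omega) (by simp; omega)
  have sl : simpleRefl i (lo j) = lo i := by rw [← hb, simpleRefl_hi]
  ext1 a
  simp only [Equiv.Perm.mul_apply]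
  by_cases h₁ : a = lo i
  · simp [h₁, hb, si, sj]
  by_cases h₂ : a = lo j
  · simp [h₂, si, sj, sl, hb]
  by_cases h₃ : a = hi j
  · simp [h₃, si, sj, sl]
  have e₁ : simpleRefl i a = a :=
    simpleRefl_of_ne (fun h => h₁ (Fin.ext h)) fun h => h₂ (hb ▸ Fin.ext h)
  have e₂ : simpleRefl j a = a :=
    simpleRefl_of_ne (fun h => h₂ (Fin.ext h)) fun h => h₃ (Fin.ext h)
  simp only [e₁, e₂]

/-- The set of inversions of a permutation. -/
def inversions {n : ℕ} (w : Equiv.Perm (Fin n)) : Finset (Fin n × Fin n) :=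
  Finset.univ.filter fun p => p.1 < p.2 ∧ w p.2 < w p.1

theorem mem_inversions {n : ℕ} {w : Equiv.Perm (Fin n)} {p : Fin n × Fin n} :
    p ∈ inversions w ↔ p.1 < p.2 ∧ w p.2 < w p.1 := by simp [inversions]

/-- A simple reflection keeps the order of every pair except `(i, i + 1)`. Relabelling both
coordinates therefore carries old inversions to new ones, and that single pair is added. -/
theorem card_inversions_mul {n : ℕ} {w : Equiv.Perm (Fin n)} {i : Fin (n - 1)}
    (h : w (lo i) < w (hi i)) :
    (inversions (w * simpleRefl i)).card = (inversions w).card + 1 := by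
  have key : inversions (w * simpleRefl i) = insert (lo i, hi i)
      ((inversions w).map (Equiv.prodCongr (simpleRefl i) (simpleRefl i)).toEmbedding) := by
    ext ⟨a, b⟩
    simp only [mem_inversions, Finset.mem_insert, Finset.mem_map_equiv, Equiv.Perm.mul_apply,
      Prod.mk.injEq]
    have e : ∀ x : Fin n, (simpleRefl i).symm x = simpleRefl i x := fun x => by
      rw [Equiv.symm_apply_eq]; simp
    simp only [Equiv.prodCongr_symm, Equiv.prodCongr_apply, Prod.map, e]
    constructor
    · rintro ⟨h₁, h₂⟩
      by_cases hab : (a : ℕ) = i ∧ (b : ℕ) = i + 1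
      · exact Or.inl ⟨Fin.ext hab.1, Fin.ext hab.2⟩
      · exact Or.inr ⟨simpleRefl_lt h₁ hab, h₂⟩
    · rintro (⟨rfl, rfl⟩ | ⟨h₁, h₂⟩)
      · refine ⟨by simp [Fin.lt_def], by simpa using h⟩
      · refine ⟨?_, h₂⟩
        by_cases hab : (simpleRefl i a : ℕ) = i ∧ (simpleRefl i b : ℕ) = i + 1
        · have e1 : simpleRefl i a = lo i := Fin.ext hab.1
          have e2 : simpleRefl i b = hi i := Fin.ext hab.2
          rw [e1, e2] at h₂
          exact absurd h (not_lt.2 h₂.le)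
        · simpa using simpleRefl_lt h₁ hab
  rw [key, Finset.card_insert_of_notMem, Finset.card_map]
  simp only [Finset.mem_map_equiv, mem_inversions]
  have e : ∀ x : Fin n, (simpleRefl i).symm x = simpleRefl i x := fun x => by
    rw [Equiv.symm_apply_eq]; simp
  simp only [Equiv.prodCongr_symm, Equiv.prodCongr_apply, Prod.map, e, simpleRefl_lo,
    simpleRefl_hi, not_and_or, not_lt]
  exact Or.inl (by simp [Fin.le_def])

theorem lt_or_gt_lo_hi {n : ℕ} (w : Equiv.Perm (Fin n)) (i : Fin (n - 1)) :
    w (lo i) < w (hi i) ∨ w (hi i) < w (lo i) :=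
  lt_or_gt_of_ne fun h => lo_ne_hi i (w.injective h)

/-- Without descents `w` is an order automorphism of a finite chain, hence trivial. -/
theorem eq_one_of_no_descent {n : ℕ} {w : Equiv.Perm (Fin n)}
    (h : ∀ i, w (lo i) < w (hi i)) : w = 1 := by
  cases n with
  | zero => exact Subsingleton.elim _ _
  | succ m =>
    have hm : StrictMono w := Fin.strictMono_iff_lt_succ.2 fun i => h i
    have := Subsingleton.elim (hm.orderIsoOfSurjective _ w.surjective) (OrderIso.refl (Fin (m + 1)))
    ext a
    exact congrArg Fin.val (congrArg (fun f : Fin (m + 1) ≃o Fin (m + 1) => f a) this)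

theorem wordProd_nil {n : ℕ} : wordProd ([] : List (Fin (n - 1))) = 1 := rfl

theorem wordProd_cons {n : ℕ} (i : Fin (n - 1)) (l : List (Fin (n - 1))) :
    wordProd (i :: l) = simpleRefl i * wordProd l := by simp [wordProd]

theorem wordProd_append {n : ℕ} (l k : List (Fin (n - 1))) :
    wordProd (l ++ k) = wordProd l * wordProd k := by simp [wordProd]

theorem wordProd_reverse {n : ℕ} (l : List (Fin (n - 1))) :
    wordProd l.reverse = (wordProd l)⁻¹ := by
  induction l with
  | nil => rfl
  | cons i l ih =>
    rw [List.reverse_cons, wordProd_append, ih, wordProd_cons, wordProd_cons, wordProd_nil]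
    simp

theorem card_inversions_le {n : ℕ} (l : List (Fin (n - 1))) :
    (inversions (wordProd l)).card ≤ l.length := by
  induction l using List.reverseRecOn with
  | nil =>
    simp only [List.length_nil, Nat.le_zero, Finset.card_eq_zero, wordProd_nil]
    refine Finset.eq_empty_of_forall_notMem fun p hp => ?_
    obtain ⟨h, h'⟩ := mem_inversions.1 hp
    exact lt_asymm h h'
  | append_singleton l i ih =>
    rw [wordProd_append, wordProd_cons, wordProd_nil, mul_one, List.length_append,
      List.length_singleton]
    rcases lt_or_gt_lo_hi (wordProd l) i with h | h
    · rw [card_inversions_mul h]; omega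
    · have := card_inversions_mul (w := wordProd l * simpleRefl i) (i := i) (by simpa using h)
      rw [mul_simpleRefl_cancel_right] at this
      omega

theorem exists_word_card_inversions {n : ℕ} (k : ℕ) (w : Equiv.Perm (Fin n))
    (hk : (inversions w).card = k) :
    ∃ l : List (Fin (n - 1)), l.length = k ∧ wordProd l = w := by
  induction k generalizing w with
  | zero =>
    refine ⟨[], rfl, (eq_one_of_no_descent fun i => ?_).symm⟩
    rcases lt_or_gt_lo_hi w i with h | h
    · exact h
    · have := card_inversions_mul (w := w * simpleRefl i) (i := i) (by simpa using h)
      rw [mul_simpleRefl_cancel_right] at this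
      omega
  | succ k ih =>
    by_cases hd : ∃ i, w (hi i) < w (lo i)
    · obtain ⟨i, h⟩ := hd
      have := card_inversions_mul (w := w * simpleRefl i) (i := i) (by simpa using h)
      rw [mul_simpleRefl_cancel_right] at this
      obtain ⟨l, hl, hw⟩ := ih (w * simpleRefl i) (by omega)
      refine ⟨l ++ [i], by simp [hl], ?_⟩
      rw [wordProd_append, hw, wordProd_cons, wordProd_nil, mul_one, mul_simpleRefl_cancel_right]
    · have h1 : w = 1 := eq_one_of_no_descent fun i =>
        (lt_or_gt_lo_hi w i).resolve_right fun h => hd ⟨i, h⟩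
      have := card_inversions_le ([] : List (Fin (n - 1)))
      rw [wordProd_nil, ← h1] at this
      rw [hk] at this
      simp at this

theorem length_le {n : ℕ} (l : List (Fin (n - 1))) : length (wordProd l) ≤ l.length :=
  Nat.sInf_le ⟨l, rfl, rfl⟩

theorem length_eq_card_inversions {n : ℕ} (w : Equiv.Perm (Fin n)) :
    length w = (inversions w).card := by
  apply le_antisymm
  · obtain ⟨l, hl, rfl⟩ := exists_word_card_inversions _ w rfl
    rw [← hl]; exact length_le l
  · obtain ⟨l, rfl, hl⟩ := exists_reducedWord w
    rw [← hl]; exact card_inversions_le l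

theorem length_inv_le {n : ℕ} (w : Equiv.Perm (Fin n)) : length w⁻¹ ≤ length w := by
  obtain ⟨l, rfl, hl⟩ := exists_reducedWord w
  rw [← hl, ← wordProd_reverse, ← List.length_reverse]
  exact length_le _

@[simp] theorem length_inv {n : ℕ} (w : Equiv.Perm (Fin n)) : length w⁻¹ = length w :=
  le_antisymm (length_inv_le w) (by simpa using length_inv_le w⁻¹)

@[simp] theorem length_one {n : ℕ} : length (1 : Equiv.Perm (Fin n)) = 0 :=
  Nat.le_zero.1 (length_le [])

theorem length_mul_simpleRefl {n : ℕ} {w : Equiv.Perm (Fin n)} {i : Fin (n - 1)}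
    (h : w (lo i) < w (hi i)) : length (w * simpleRefl i) = length w + 1 := by
  simp only [length_eq_card_inversions, card_inversions_mul h]

theorem length_simpleRefl_mul {n : ℕ} {w : Equiv.Perm (Fin n)} {i : Fin (n - 1)}
    (h : w⁻¹ (lo i) < w⁻¹ (hi i)) : length (simpleRefl i * w) = length w + 1 := by
  rw [← length_inv, mul_inv_rev, simpleRefl_inv, length_mul_simpleRefl h, length_inv]

theorem length_simpleRefl_mul_of_gt {n : ℕ} {w : Equiv.Perm (Fin n)} {i : Fin (n - 1)}
    (h : w⁻¹ (hi i) < w⁻¹ (lo i)) : length w = length (simpleRefl i * w) + 1 := by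
  rw [← length_simpleRefl_mul (i := i), simpleRefl_mul_cancel_left]
  simpa using h

/-- A permutation is built from `1` by length-increasing right multiplications. -/
theorem right_induction {n : ℕ} {P : Equiv.Perm (Fin n) → Prop} (one : P 1)
    (step : ∀ w i, w (lo i) < w (hi i) → P w → P (w * simpleRefl i)) (w : Equiv.Perm (Fin n)) :
    P w := by
  induction hk : length w using Nat.strong_induction_on generalizing w with
  | _ k ih =>
    by_cases hd : ∃ i, w (hi i) < w (lo i)
    · obtain ⟨i, h⟩ := hd
      have h' : (w * simpleRefl i) (lo i) < (w * simpleRefl i) (hi i) := by simpa using h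
      have hl := length_mul_simpleRefl h'
      rw [mul_simpleRefl_cancel_right] at hl
      have := step _ i h' (ih _ (by omega) (w * simpleRefl i) rfl)
      rwa [mul_simpleRefl_cancel_right] at this
    · rw [eq_one_of_no_descent fun i => (lt_or_gt_lo_hi w i).resolve_right fun h => hd ⟨i, h⟩]
      exact one

/-! ### Independence of the reduced expression -/

theorem gen_comm {n : ℕ} {i j : Fin (n - 1)} (h : (i : ℕ) + 2 ≤ j) :
    (gen i * gen j : Hecke n) = gen j * gen i := by
  simp only [gen, ← map_mul]
  exact RingQuot.mkAlgHom_rel _ (HeckeRel.comm i j h)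

theorem gen_braid {n : ℕ} {i j : Fin (n - 1)} (h : (i : ℕ) + 1 = j) :
    (gen i * gen j * gen i : Hecke n) = gen j * gen i * gen j := by
  simp only [gen, ← map_mul]
  exact RingQuot.mkAlgHom_rel _ (HeckeRel.braid i j h)

theorem gen_sq {n : ℕ} (i : Fin (n - 1)) :
    (gen i * gen i : Hecke n) = 1 + (X : ℤ[X]) • gen i := by
  have := RingQuot.mkAlgHom_rel ℤ[X] (HeckeRel.quad i)
  simpa [gen] using this

theorem IsReducedWord.tail {n : ℕ} {i : Fin (n - 1)} {l : List (Fin (n - 1))}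
    {w : Equiv.Perm (Fin n)} (h : IsReducedWord (i :: l) w) :
    IsReducedWord l (simpleRefl i * w) ∧ w⁻¹ (hi i) < w⁻¹ (lo i) := by
  obtain ⟨hw, hl⟩ := h
  rw [wordProd_cons] at hw
  have hw' : wordProd l = simpleRefl i * w := by rw [← hw, simpleRefl_mul_cancel_left]
  have h1 := length_le l
  rw [hw'] at h1
  rw [List.length_cons] at hl
  have hlt : w⁻¹ (hi i) < w⁻¹ (lo i) := by
    rcases lt_or_gt_lo_hi w⁻¹ i with h | h
    · have := length_simpleRefl_mul h
      omega
    · exact h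
  have := length_simpleRefl_mul_of_gt hlt
  exact ⟨⟨hw', by omega⟩, hlt⟩

theorem IsReducedWord.cons {n : ℕ} {i : Fin (n - 1)} {l : List (Fin (n - 1))}
    {w : Equiv.Perm (Fin n)} (h : IsReducedWord l (simpleRefl i * w))
    (hlt : w⁻¹ (hi i) < w⁻¹ (lo i)) : IsReducedWord (i :: l) w := by
  refine ⟨by rw [wordProd_cons, h.1, simpleRefl_mul_cancel_left], ?_⟩
  rw [length_simpleRefl_mul_of_gt hlt, List.length_cons, h.2]

/-- Matsumoto's theorem, by induction on length. The first letters `i`, `j` of two reduced words are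
both left descents, so there are also reduced words beginning with the two expressions of the
longest element of `⟨s_i, s_j⟩`. Each given word shares its first letter with one of these, and the
two differ by one defining relation. -/
theorem prod_gen_eq_of_isReducedWord {n : ℕ} (k : ℕ) :
    ∀ (l l' : List (Fin (n - 1))) (w : Equiv.Perm (Fin n)), l.length = k → IsReducedWord l w →
      IsReducedWord l' w → (l.map (gen (n := n))).prod = (l'.map gen).prod := by
  induction k with
  | zero =>
    intro l l' w hk h h'
    have : l'.length = 0 := by rw [h'.2, ← h.2, hk]
    rw [List.length_eq_zero_iff.1 hk, List.length_eq_zero_iff.1 this]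
  | succ k ih =>
    have main : ∀ (i j : Fin (n - 1)) (l l' : List (Fin (n - 1))) (w : Equiv.Perm (Fin n)),
        l.length = k → IsReducedWord (i :: l) w → IsReducedWord (j :: l') w → (i : ℕ) ≤ j →
        ((i :: l).map (gen (n := n))).prod = ((j :: l').map gen).prod := by
      intro i j l l' w hk h h' hij
      obtain ⟨h1, d1⟩ := h.tail
      obtain ⟨h2, d2⟩ := h'.tail
      have hk' : l'.length = k := by
        have e1 := h.2
        have e2 := h'.2
        simp only [List.length_cons] at e1 e2
        omega
      simp only [List.map_cons, List.prod_cons]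
      obtain hij | hij | hij : (i : ℕ) = j ∨ (i : ℕ) + 1 = j ∨ (i : ℕ) + 2 ≤ j := by omega
      · obtain rfl := Fin.ext hij
        rw [ih l l' _ hk h1 h2]
      · have hb : hi i = lo j := Fin.ext (by simpa using hij)
        have si : simpleRefl i (hi j) = hi j :=
          simpleRefl_of_ne (by simp; omega) (by simp; omega)
        have sj : simpleRefl j (lo i) = lo i :=
          simpleRefl_of_ne (by simp; omega) (by simp; omega)
        have sl : simpleRefl i (lo j) = lo i := by rw [← hb, simpleRefl_hi]
        have sh : simpleRefl j (hi i) = hi j := by rw [hb, simpleRefl_lo]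
        rw [hb] at d1
        -- Here `r` is what remains of `w` after removing `s_i s_j s_i`; the words compared are `i j
        -- i r` and `j i j r`.
        obtain ⟨r, hr⟩ := exists_reducedWord (simpleRefl i * (simpleRefl j * (simpleRefl i * w)))
        have hr' : IsReducedWord r (simpleRefl j * (simpleRefl i * (simpleRefl j * w))) := by
          have := simpleRefl_braid hij
          simp only [← mul_assoc] at hr ⊢
          rwa [← this]
        have e1 : IsReducedWord (j :: i :: r) (simpleRefl i * w) := by
          refine (hr.cons ?_).cons ?_
          · simp only [mul_inv_rev, simpleRefl_inv, Equiv.Perm.mul_apply, sj, si,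
              simpleRefl_lo, hb]
            exact d2
          · simp only [mul_inv_rev, simpleRefl_inv, Equiv.Perm.mul_apply, si, sl]
            exact d2.trans d1
        have e2 : IsReducedWord (i :: j :: r) (simpleRefl j * w) := by
          refine (hr'.cons ?_).cons ?_
          · simp only [mul_inv_rev, simpleRefl_inv, Equiv.Perm.mul_apply, sj, si, sl,
              simpleRefl_hi]
            exact d1
          · simp only [mul_inv_rev, simpleRefl_inv, Equiv.Perm.mul_apply, sj, sh]
            exact d2.trans d1
        rw [ih l _ _ hk h1 e1, ih l' _ _ hk' h2 e2]
        simp only [List.map_cons, List.prod_cons, ← mul_assoc]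
        rw [gen_braid hij]
      · have a1 : simpleRefl i (lo j) = lo j := simpleRefl_of_ne (by simp; omega) (by simp; omega)
        have a2 : simpleRefl i (hi j) = hi j := simpleRefl_of_ne (by simp; omega) (by simp; omega)
        have a3 : simpleRefl j (lo i) = lo i := simpleRefl_of_ne (by simp; omega) (by simp; omega)
        have a4 : simpleRefl j (hi i) = hi i := simpleRefl_of_ne (by simp; omega) (by simp; omega)
        obtain ⟨r, hr⟩ := exists_reducedWord (simpleRefl j * (simpleRefl i * w))
        have hr' : IsReducedWord r (simpleRefl i * (simpleRefl j * w)) := by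
          rw [← mul_assoc, simpleRefl_comm hij, mul_assoc]
          exact hr
        have e1 : IsReducedWord (j :: r) (simpleRefl i * w) := by
          refine hr.cons ?_
          simpa [mul_inv_rev, Equiv.Perm.mul_apply, a1, a2] using d2
        have e2 : IsReducedWord (i :: r) (simpleRefl j * w) := by
          refine hr'.cons ?_
          simpa [mul_inv_rev, Equiv.Perm.mul_apply, a3, a4] using d1
        rw [ih l _ _ hk h1 e1, ih l' _ _ hk' h2 e2]
        simp only [List.map_cons, List.prod_cons, ← mul_assoc]
        rw [gen_comm hij]
    intro l l' w hk h h'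
    have hk' : l'.length = k + 1 := by rw [h'.2, ← h.2, hk]
    match l, l', hk, hk', h, h' with
    | i :: l, j :: l', hk, hk', h, h' =>
      rw [List.length_cons] at hk hk'
      rcases le_total (i : ℕ) j with hij | hij
      · exact main i j l l' w (by omega) h h' hij
      · exact (main j i l' l w (by omega) h' h hij).symm

theorem T_eq_of_isReducedWord {n : ℕ} {l : List (Fin (n - 1))} {w : Equiv.Perm (Fin n)}
    (h : IsReducedWord l w) : T w = (l.map gen).prod :=
  prod_gen_eq_of_isReducedWord _ _ _ w rfl (exists_reducedWord w).choose_spec h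

@[simp] theorem T_one {n : ℕ} : T (1 : Equiv.Perm (Fin n)) = 1 :=
  T_eq_of_isReducedWord (l := []) ⟨rfl, by simp⟩

theorem T_mul_simpleRefl {n : ℕ} {w : Equiv.Perm (Fin n)} {i : Fin (n - 1)}
    (h : w (lo i) < w (hi i)) : T (w * simpleRefl i) = T w * gen i := by
  obtain ⟨l, hl⟩ := exists_reducedWord w
  have : IsReducedWord (l ++ [i]) (w * simpleRefl i) :=
    ⟨by rw [wordProd_append, hl.1, wordProd_cons, wordProd_nil, mul_one],
      by rw [length_mul_simpleRefl h, List.length_append, hl.2, List.length_singleton]⟩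
  rw [T_eq_of_isReducedWord this, T_eq_of_isReducedWord hl]
  simp

theorem T_simpleRefl_mul {n : ℕ} {w : Equiv.Perm (Fin n)} {i : Fin (n - 1)}
    (h : w⁻¹ (lo i) < w⁻¹ (hi i)) : T (simpleRefl i * w) = gen i * T w := by
  obtain ⟨l, hl⟩ := exists_reducedWord w
  have : IsReducedWord (i :: l) (simpleRefl i * w) :=
    IsReducedWord.cons (by simpa using hl) (by simpa using h)
  rw [T_eq_of_isReducedWord this, T_eq_of_isReducedWord hl]
  simp

theorem gen_mul_T_of_gt {n : ℕ} {w : Equiv.Perm (Fin n)} {i : Fin (n - 1)}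
    (h : w⁻¹ (hi i) < w⁻¹ (lo i)) :
    gen i * T w = T (simpleRefl i * w) + (X : ℤ[X]) • T w := by
  have e := T_simpleRefl_mul (w := simpleRefl i * w) (i := i) (by simpa using h)
  rw [simpleRefl_mul_cancel_left] at e
  conv_lhs => rw [e, ← mul_assoc, gen_sq, add_mul, one_mul, smul_mul_assoc, ← e]

theorem isUnit_gen {n : ℕ} (i : Fin (n - 1)) : IsUnit (gen i : Hecke n) := by
  refine ⟨⟨gen i, gen i + (-X : ℤ[X]) • 1, ?_, ?_⟩, rfl⟩
  · rw [mul_add, gen_sq, mul_smul_comm, mul_one, add_assoc, ← add_smul, add_neg_cancel, zero_smul,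
      add_zero]
  · rw [add_mul, gen_sq, smul_mul_assoc, one_mul, add_assoc, ← add_smul, add_neg_cancel, zero_smul,
      add_zero]

theorem isUnit_T {n : ℕ} (w : Equiv.Perm (Fin n)) : IsUnit (T w) := by
  induction w using right_induction with
  | one => simp
  | step w i h ih => rw [T_mul_simpleRefl h]; exact ih.mul (isUnit_gen i)

/-! ### The regular representation and the symmetrizing trace -/

/-- The operator of left multiplication by a generator on the free module over `S_n`. -/
noncomputable def leftOp {n : ℕ} (i : Fin (n - 1)) :
    Module.End ℤ[X] (Equiv.Perm (Fin n) →₀ ℤ[X]) :=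
  Finsupp.linearCombination ℤ[X] fun w =>
    Finsupp.single (simpleRefl i * w) 1 +
      if w⁻¹ (hi i) < w⁻¹ (lo i) then (X : ℤ[X]) • Finsupp.single w 1 else 0

theorem leftOp_of_lt {n : ℕ} {i : Fin (n - 1)} {w : Equiv.Perm (Fin n)}
    (h : w⁻¹ (lo i) < w⁻¹ (hi i)) :
    leftOp i (Finsupp.single w 1) = Finsupp.single (simpleRefl i * w) 1 := by
  rw [leftOp, Finsupp.linearCombination_single, one_smul, if_neg (not_lt.2 h.le), add_zero]

theorem leftOp_of_gt {n : ℕ} {i : Fin (n - 1)} {w : Equiv.Perm (Fin n)}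
    (h : w⁻¹ (hi i) < w⁻¹ (lo i)) :
    leftOp i (Finsupp.single w 1) =
      Finsupp.single (simpleRefl i * w) 1 + (X : ℤ[X]) • Finsupp.single w 1 := by
  rw [leftOp, Finsupp.linearCombination_single, one_smul, if_pos h]

theorem end_ext {n : ℕ} {f g : Module.End ℤ[X] (Equiv.Perm (Fin n) →₀ ℤ[X])}
    (h : ∀ w, f (Finsupp.single w 1) = g (Finsupp.single w 1)) : f = g :=
  Finsupp.lhom_ext' fun w => LinearMap.ext_ring (h w)

theorem leftOp_sq {n : ℕ} (i : Fin (n - 1)) :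
    leftOp i * leftOp i = 1 + (X : ℤ[X]) • leftOp i := by
  refine end_ext fun w => ?_
  simp only [Module.End.mul_apply, LinearMap.add_apply, Module.End.one_apply, LinearMap.smul_apply]
  rcases lt_or_gt_lo_hi w⁻¹ i with h | h
  · rw [leftOp_of_lt h, leftOp_of_gt (by simpa using h), simpleRefl_mul_cancel_left]
  · rw [leftOp_of_gt h, map_add, map_smul, leftOp_of_lt (by simpa using h),
      simpleRefl_mul_cancel_left, leftOp_of_gt h]

theorem leftOp_comm {n : ℕ} {i j : Fin (n - 1)} (hij : (i : ℕ) + 2 ≤ j) :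
    leftOp i * leftOp j = leftOp j * leftOp i := by
  have a1 : simpleRefl i (lo j) = lo j := simpleRefl_of_ne (by simp; omega) (by simp; omega)
  have a2 : simpleRefl i (hi j) = hi j := simpleRefl_of_ne (by simp; omega) (by simp; omega)
  have a3 : simpleRefl j (lo i) = lo i := simpleRefl_of_ne (by simp; omega) (by simp; omega)
  have a4 : simpleRefl j (hi i) = hi i := simpleRefl_of_ne (by simp; omega) (by simp; omega)
  refine end_ext fun w => ?_
  have e : simpleRefl i * (simpleRefl j * w) = simpleRefl j * (simpleRefl i * w) := by
    simp only [← mul_assoc, simpleRefl_comm hij]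
  simp only [Module.End.mul_apply]
  rcases lt_or_gt_lo_hi w⁻¹ i with h | h <;> rcases lt_or_gt_lo_hi w⁻¹ j with h' | h' <;>
  · simp only [leftOp_of_lt, leftOp_of_gt, h, h', mul_inv_rev, simpleRefl_inv,
      Equiv.Perm.mul_apply, a1, a2, a3, a4, map_add, map_smul, e]
    try module

theorem leftOp_braid {n : ℕ} {i j : Fin (n - 1)} (hij : (i : ℕ) + 1 = j) :
    leftOp i * leftOp j * leftOp i = leftOp j * leftOp i * leftOp j := by
  have hb : hi i = lo j := Fin.ext (by simpa using hij)
  have si : simpleRefl i (hi j) = hi j := simpleRefl_of_ne (by simp; omega) (by simp; omega)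
  have sj : simpleRefl j (lo i) = lo i := simpleRefl_of_ne (by simp; omega) (by simp; omega)
  have sl : simpleRefl i (lo j) = lo i := by rw [← hb, simpleRefl_hi]
  have si' : simpleRefl i (lo i) = lo j := by rw [simpleRefl_lo, hb]
  refine end_ext fun w => ?_
  have e : simpleRefl i * (simpleRefl j * (simpleRefl i * w)) =
      simpleRefl j * (simpleRefl i * (simpleRefl j * w)) := by
    simp only [← mul_assoc, simpleRefl_braid hij]
  -- With `hi i` rewritten as `lo j`, every case condition compares values of `w⁻¹` at the same
  -- three points, and the cases are the orderings of these values.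
  have L1 : ∀ u : Equiv.Perm (Fin n), u⁻¹ (lo i) < u⁻¹ (lo j) → leftOp i (Finsupp.single u 1) =
      Finsupp.single (simpleRefl i * u) 1 := fun u hu => leftOp_of_lt (by rwa [hb])
  have L2 : ∀ u : Equiv.Perm (Fin n), u⁻¹ (lo j) < u⁻¹ (lo i) → leftOp i (Finsupp.single u 1) =
      Finsupp.single (simpleRefl i * u) 1 + (X : ℤ[X]) • Finsupp.single u 1 :=
    fun u hu => leftOp_of_gt (by rwa [hb])
  have L3 : ∀ u : Equiv.Perm (Fin n), u⁻¹ (lo j) < u⁻¹ (hi j) → leftOp j (Finsupp.single u 1) =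
      Finsupp.single (simpleRefl j * u) 1 := fun u hu => leftOp_of_lt hu
  have L4 : ∀ u : Equiv.Perm (Fin n), u⁻¹ (hi j) < u⁻¹ (lo j) → leftOp j (Finsupp.single u 1) =
      Finsupp.single (simpleRefl j * u) 1 + (X : ℤ[X]) • Finsupp.single u 1 :=
    fun u hu => leftOp_of_gt hu
  have h₃ : w⁻¹ (lo i) < w⁻¹ (hi j) ∨ w⁻¹ (hi j) < w⁻¹ (lo i) :=
    lt_or_gt_of_ne fun h => by
      have := congrArg Fin.val (w⁻¹.injective h)
      simp at this
      omega
  have h₁ := lt_or_gt_lo_hi w⁻¹ i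
  rw [hb] at h₁
  simp only [Module.End.mul_apply]
  rcases h₁ with h₁ | h₁ <;> rcases lt_or_gt_lo_hi w⁻¹ j with h₂ | h₂ <;> rcases h₃ with h₃ | h₃ <;>
  first
  | exact absurd (h₁.trans h₂) (lt_asymm h₃)
  | exact absurd (h₂.trans h₁) (lt_asymm h₃)
  | simp only [L1, L2, L3, L4, h₁, h₂, h₃, mul_inv_rev, simpleRefl_inv, Equiv.Perm.mul_apply,
      si, sj, sl, si', simpleRefl_lo, simpleRefl_hi, map_add, map_smul, e,
      simpleRefl_mul_cancel_left]
    try module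

/-- The regular representation of the Hecke algebra. -/
noncomputable def regularRep (n : ℕ) :
    Hecke n →ₐ[ℤ[X]] Module.End ℤ[X] (Equiv.Perm (Fin n) →₀ ℤ[X]) :=
  RingQuot.liftAlgHom ℤ[X] ⟨FreeAlgebra.lift ℤ[X] leftOp, by
    intro x y h
    cases h with
    | comm i j h => simpa using leftOp_comm h
    | braid i j h => simpa using leftOp_braid h
    | quad i => simpa using leftOp_sq i⟩

theorem regularRep_gen {n : ℕ} (i : Fin (n - 1)) : regularRep n (gen i) = leftOp i := by
  simp [regularRep, gen]

theorem left_induction {n : ℕ} {P : Equiv.Perm (Fin n) → Prop} (one : P 1)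
    (step : ∀ w i, w⁻¹ (lo i) < w⁻¹ (hi i) → P w → P (simpleRefl i * w))
    (w : Equiv.Perm (Fin n)) : P w := by
  have : P w⁻¹⁻¹ := right_induction (P := fun w => P w⁻¹) (by simpa using one)
    (fun w i h hw => by simpa using step w⁻¹ i (by simpa using h) hw) w⁻¹
  simpa using this

/-- The algebra is known only by a presentation. Acting on the basis vector at `1` separates the `T
w`, so taking the coefficient of `T 1` is meaningful. -/
theorem regularRep_T {n : ℕ} (w : Equiv.Perm (Fin n)) :
    regularRep n (T w) (Finsupp.single 1 1) = Finsupp.single w 1 := by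
  induction w using left_induction with
  | one => simp
  | step w i h ih =>
    rw [T_simpleRefl_mul h, map_mul, Module.End.mul_apply, ih, regularRep_gen, leftOp_of_lt h]

/-- The symmetrizing trace: the coefficient of `T_1`. -/
noncomputable def trace (n : ℕ) : Hecke n →ₗ[ℤ[X]] ℤ[X] :=
  Finsupp.lapply 1 ∘ₗ LinearMap.applyₗ (Finsupp.single 1 1) ∘ₗ (regularRep n).toLinearMap

theorem trace_T {n : ℕ} (w : Equiv.Perm (Fin n)) : trace n (T w) = if w = 1 then 1 else 0 := by
  simp [trace, regularRep_T, Finsupp.single_apply]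

/-- Generators pass one by one from `x` to `y`. The extra quadratic term contributes only if `x =
y⁻¹`, which is impossible: `x` has an ascent at `i` where `y⁻¹` has a descent. -/
theorem trace_T_mul_T {n : ℕ} (x y : Equiv.Perm (Fin n)) :
    trace n (T x * T y) = if x * y = 1 then 1 else 0 := by
  induction x using right_induction generalizing y with
  | one => simp [trace_T]
  | step x i h ih =>
    rw [T_mul_simpleRefl h, mul_assoc]
    rcases lt_or_gt_lo_hi y⁻¹ i with hy | hy
    · rw [← T_simpleRefl_mul hy, ih, mul_assoc]
    · rw [gen_mul_T_of_gt hy, mul_add, map_add, ih, mul_smul_comm, map_smul, ih, mul_assoc,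
        if_neg (c := x * y = 1), smul_zero, add_zero]
      intro hxy
      rw [← eq_inv_iff_mul_eq_one] at hxy
      rw [← hxy] at hy
      exact lt_asymm h hy

/-- The span contains `1` and is stable under left multiplication by generators, so it is a left
ideal containing `1`. -/
theorem span_T (n : ℕ) : Submodule.span ℤ[X] (Set.range (T (n := n))) = ⊤ := by
  have hgen : ∀ (i : Fin (n - 1)), ∀ h ∈ Submodule.span ℤ[X] (Set.range (T (n := n))),
      gen i * h ∈ Submodule.span ℤ[X] (Set.range (T (n := n))) := by
    intro i h hh
    induction hh using Submodule.span_induction with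
    | mem x hx =>
      obtain ⟨w, rfl⟩ := hx
      rcases lt_or_gt_lo_hi w⁻¹ i with hw | hw
      · rw [← T_simpleRefl_mul hw]
        exact Submodule.subset_span ⟨_, rfl⟩
      · rw [gen_mul_T_of_gt hw]
        exact add_mem (Submodule.subset_span ⟨_, rfl⟩)
          (Submodule.smul_mem _ _ (Submodule.subset_span ⟨_, rfl⟩))
    | zero => rw [mul_zero]; exact zero_mem _
    | add x y _ _ hx hy => rw [mul_add]; exact add_mem hx hy
    | smul a x _ hx => rw [mul_smul_comm]; exact Submodule.smul_mem _ _ hx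
  have hall : ∀ (a : FreeAlgebra ℤ[X] (Fin (n - 1))),
      ∀ h ∈ Submodule.span ℤ[X] (Set.range (T (n := n))),
      RingQuot.mkAlgHom ℤ[X] (HeckeRel n) a * h ∈
        Submodule.span ℤ[X] (Set.range (T (n := n))) := by
    intro a
    induction a using FreeAlgebra.induction with
    | grade0 r =>
      intro h hh
      rw [AlgHom.commutes, ← Algebra.smul_def]
      exact Submodule.smul_mem _ _ hh
    | grade1 i => exact hgen i
    | mul a b ha hb =>
      intro h hh
      rw [map_mul, mul_assoc]
      exact ha _ (hb _ hh)
    | add a b ha hb =>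
      intro h hh
      rw [map_add, add_mul]
      exact add_mem (ha _ hh) (hb _ hh)
  rw [eq_top_iff]
  rintro h -
  obtain ⟨a, rfl⟩ := RingQuot.mkAlgHom_surjective ℤ[X] (HeckeRel n) h
  have := hall a 1 (Submodule.subset_span ⟨1, T_one⟩)
  rwa [mul_one] at this

theorem hecke_induction {n : ℕ} {P : Hecke n → Prop} (hT : ∀ w, P (T w)) (h0 : P 0)
    (hadd : ∀ a b, P a → P b → P (a + b)) (hsmul : ∀ (r : ℤ[X]) a, P a → P (r • a))
    (h : Hecke n) : P h := by
  have hh : h ∈ Submodule.span ℤ[X] (Set.range (T (n := n))) := by rw [span_T]; trivial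
  induction hh using Submodule.span_induction with
  | mem x hx => obtain ⟨w, rfl⟩ := hx; exact hT w
  | zero => exact h0
  | add x y _ _ hx hy => exact hadd x y hx hy
  | smul a x _ hx => exact hsmul a x hx

theorem trace_mul_comm {n : ℕ} (a b : Hecke n) : trace n (a * b) = trace n (b * a) := by
  induction a using hecke_induction with
  | hT x =>
    induction b using hecke_induction with
    | hT y =>
      rw [trace_T_mul_T, trace_T_mul_T]
      exact if_congr mul_eq_one_comm rfl rfl
    | h0 => simp
    | hadd a b ha hb => rw [mul_add, add_mul, map_add, map_add, ha, hb]
    | hsmul r a ha => rw [mul_smul_comm, smul_mul_assoc, map_smul, map_smul, ha]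
  | h0 => simp
  | hadd a b ha hb => rw [mul_add, add_mul, map_add, map_add, ha, hb]
  | hsmul r a ha => rw [mul_smul_comm, smul_mul_assoc, map_smul, map_smul, ha]

/-- The bases `T_w` and `T_{w⁻¹}` are dual for the trace. -/
theorem sum_trace_smul {n : ℕ} (u : Hecke n) : ∑ w, trace n (T w * u) • T w⁻¹ = u := by
  induction u using hecke_induction with
  | hT y =>
    simp only [trace_T_mul_T]
    rw [Finset.sum_eq_single y⁻¹]
    · simp
    · intro w _ hw
      rw [if_neg fun h => hw (eq_inv_iff_mul_eq_one.2 h), zero_smul]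
    · simp
  | h0 => simp
  | hadd a b ha hb => simp only [mul_add, map_add, add_smul, Finset.sum_add_distrib, ha, hb]
  | hsmul r a ha => simp only [mul_smul_comm, map_smul, smul_assoc, ← Finset.smul_sum, ha]

theorem sum_trace_smul' {n : ℕ} (u : Hecke n) : ∑ w, trace n (T w⁻¹ * u) • T w = u := by
  conv_rhs => rw [← sum_trace_smul u]
  exact Fintype.sum_equiv (Equiv.inv _) _ _ fun w => by simp

/-! ### Young subgroups and distinguished coset representatives -/

/-- The Young subgroup generated by the `simpleRefl j` with `j ∈ J`: the permutations that
preserve every initial segment `{0, …, j}` with `j ∉ J`. -/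
def young (n : ℕ) (J : Set ℕ) : Subgroup (Equiv.Perm (Fin n)) where
  carrier := {x | ∀ j ∉ J, ∀ a : Fin n, (x a : ℕ) ≤ j ↔ (a : ℕ) ≤ j}
  one_mem' := fun _ _ _ => Iff.rfl
  mul_mem' := fun {x y} hx hy j hj a => (hx j hj (y a)).trans (hy j hj a)
  inv_mem' := fun {x} hx j hj a => by simpa using (hx j hj (x⁻¹ a)).symm

theorem simpleRefl_mem_young {n : ℕ} {J : Set ℕ} {i : Fin (n - 1)} (hi : (i : ℕ) ∈ J) :
    simpleRefl i ∈ young n J := by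
  intro j hj a
  have : (i : ℕ) ≠ j := fun h => hj (h ▸ hi)
  rw [simpleRefl_val]
  split_ifs <;> omega

/-- If `i ∉ J`, then `x` preserves `{0, …, i}`, which separates the images of `i` and `i + 1`. This
keeps length-reducing steps inside the Young subgroup. -/
theorem descent_mem_of_mem_young {n : ℕ} {J : Set ℕ} {x : Equiv.Perm (Fin n)} (hx : x ∈ young n J)
    {i : Fin (n - 1)} (h : x (hi i) < x (lo i)) : (i : ℕ) ∈ J := by
  by_contra hi'
  have h1 := (hx i hi' (lo i)).2 le_rfl
  have h2 := mt (hx i hi' (hi i)).1 (by simp)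
  rw [Fin.lt_def] at h
  omega

theorem young_induction {n : ℕ} {J : Set ℕ} {P : Equiv.Perm (Fin n) → Prop} (one : P 1)
    (step : ∀ x (i : Fin (n - 1)), x ∈ young n J → (i : ℕ) ∈ J → x⁻¹ (lo i) < x⁻¹ (hi i) → P x →
      P (simpleRefl i * x)) {x : Equiv.Perm (Fin n)} (hx : x ∈ young n J) : P x := by
  induction x using left_induction with
  | one => exact one
  | step w i h ih =>
    have hi' : (i : ℕ) ∈ J := by
      refine descent_mem_of_mem_young (inv_mem hx) (i := i) ?_
      simpa using h
    have hw : w ∈ young n J := by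
      have := mul_mem (simpleRefl_mem_young hi') hx
      rwa [simpleRefl_mul_cancel_left] at this
    exact step w i hw hi' h (ih hw)

theorem young_eq_closure (n : ℕ) (J : Set ℕ) :
    young n J = Subgroup.closure (simpleRefl '' {i : Fin (n - 1) | (i : ℕ) ∈ J}) := by
  apply le_antisymm
  · intro x hx
    refine young_induction (J := J) (one_mem _) (fun x i _ hi _ h => ?_) hx
    exact mul_mem (Subgroup.subset_closure ⟨i, hi, rfl⟩) h
  · rw [Subgroup.closure_le]
    rintro _ ⟨i, hi, rfl⟩
    exact simpleRefl_mem_young hi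

/-- `d` has no left descent in `J`. Equivalently, by `isDistinguished_iff`, it has minimal length in
its coset `(young n J) d`. -/
def IsDistinguished {n : ℕ} (J : Set ℕ) (d : Equiv.Perm (Fin n)) : Prop :=
  ∀ i : Fin (n - 1), (i : ℕ) ∈ J → d⁻¹ (lo i) < d⁻¹ (hi i)

theorem IsDistinguished.strictMonoOn {n : ℕ} {J : Set ℕ} {d : Equiv.Perm (Fin n)}
    (hd : IsDistinguished J d) {a b : Fin n} (hab : a < b)
    (h : ∀ j : ℕ, (a : ℕ) ≤ j → j < b → j ∈ J) : d⁻¹ a < d⁻¹ b := by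
  obtain ⟨a, ha⟩ := a
  obtain ⟨b, hb⟩ := b
  simp only [Fin.mk_lt_mk] at hab h
  induction b, hab using Nat.le_induction with
  | base => exact hd ⟨a, by omega⟩ (h a le_rfl (by omega))
  | succ b hab ih =>
    exact (ih (by omega) fun j h1 h2 => h j h1 (by omega)).trans
      (hd ⟨b, by omega⟩ (h b (by omega) (by omega)))

/-- The points `x⁻¹ i` and `x⁻¹ (i + 1)` lie in one block of `J`, on which `d⁻¹` is increasing. All
additivity of lengths for `x * d` rests on this. -/
theorem IsDistinguished.inv_mul_lt {n : ℕ} {J : Set ℕ} {d x : Equiv.Perm (Fin n)}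
    (hd : IsDistinguished J d) (hx : x ∈ young n J) {i : Fin (n - 1)} (hi' : (i : ℕ) ∈ J)
    (h : x⁻¹ (lo i) < x⁻¹ (hi i)) : (x * d)⁻¹ (lo i) < (x * d)⁻¹ (hi i) := by
  rw [mul_inv_rev, Equiv.Perm.mul_apply, Equiv.Perm.mul_apply]
  refine hd.strictMonoOn h fun j h1 h2 => ?_
  by_contra hj
  have e1 := (inv_mem hx j hj (lo i)).1 h1
  have e2 := mt (inv_mem hx j hj (hi i)).2 (not_le.2 h2)
  simp only [lo_val, hi_val] at e1 e2
  exact hj ((show j = i by omega) ▸ hi')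

theorem IsDistinguished.T_mul {n : ℕ} {J : Set ℕ} {d x : Equiv.Perm (Fin n)}
    (hd : IsDistinguished J d) (hx : x ∈ young n J) : T (x * d) = T x * T d := by
  refine young_induction (J := J) (P := fun x => T (x * d) = T x * T d)
    (by simp) (fun x i hx hi' h ih => ?_) hx
  rw [mul_assoc, T_simpleRefl_mul (hd.inv_mul_lt hx hi' h), ih, T_simpleRefl_mul h, mul_assoc]

/-- The mirror image of `IsDistinguished.T_mul`, needed to factor the dual basis. -/
theorem IsDistinguished.T_inv_mul_inv {n : ℕ} {J : Set ℕ} {d x : Equiv.Perm (Fin n)}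
    (hd : IsDistinguished J d) (hx : x ∈ young n J) : T (d⁻¹ * x⁻¹) = T d⁻¹ * T x⁻¹ := by
  refine young_induction (J := J) (P := fun x => T (d⁻¹ * x⁻¹) = T d⁻¹ * T x⁻¹)
    (by simp) (fun x i hx hi' h ih => ?_) hx
  have h' := hd.inv_mul_lt hx hi' h
  rw [mul_inv_rev] at h'
  rw [mul_inv_rev, simpleRefl_inv, ← mul_assoc, T_mul_simpleRefl h', ih, T_mul_simpleRefl h,
    mul_assoc]

theorem IsDistinguished.length_mul {n : ℕ} {J : Set ℕ} {d x : Equiv.Perm (Fin n)}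
    (hd : IsDistinguished J d) (hx : x ∈ young n J) : length (x * d) = length x + length d := by
  refine young_induction (J := J) (P := fun x => length (x * d) = length x + length d)
    (by simp) (fun x i hx hi' h ih => ?_) hx
  rw [mul_assoc, length_simpleRefl_mul (hd.inv_mul_lt hx hi' h), ih, length_simpleRefl_mul h]
  omega

theorem isDistinguished_iff {n : ℕ} {J : Set ℕ} {d : Equiv.Perm (Fin n)} :
    IsDistinguished J d ↔ ∀ u ∈ young n J, length d ≤ length (u * d) := by
  constructor
  · intro hd u hu
    rw [hd.length_mul hu]
    omega
  · intro h i hi'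
    refine (lt_or_gt_lo_hi d⁻¹ i).resolve_right fun hlt => ?_
    have h1 := h _ (simpleRefl_mem_young hi')
    have h2 := length_simpleRefl_mul_of_gt hlt
    omega

theorem exists_isDistinguished {n : ℕ} (J : Set ℕ) (w : Equiv.Perm (Fin n)) :
    ∃ x ∈ young n J, ∃ d, IsDistinguished J d ∧ x * d = w := by
  obtain ⟨u, hu, hmin⟩ := Set.exists_min_image (young n J : Set (Equiv.Perm (Fin n)))
    (fun u => length (u * w)) (Set.toFinite _) ⟨1, one_mem _⟩
  refine ⟨u⁻¹, inv_mem hu, u * w, isDistinguished_iff.2 fun v hv => ?_, by simp⟩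
  rw [← mul_assoc]
  exact hmin _ (mul_mem hv hu)

theorem IsDistinguished.unique {n : ℕ} {J : Set ℕ} {d u : Equiv.Perm (Fin n)}
    (hd : IsDistinguished J d) (hu : u ∈ young n J) (hud : IsDistinguished J (u * d)) : u = 1 := by
  have h1 := hd.length_mul hu
  have h2 := hud.length_mul (inv_mem hu)
  rw [inv_mul_cancel_left] at h2
  rw [length_inv] at h2
  obtain ⟨l, hl, hl'⟩ := exists_reducedWord u
  rw [List.length_eq_zero_iff.1 (show l.length = 0 by omega)] at hl
  exact hl.symm

open Classical in
/-- The distinguished representatives of the right cosets of a Young subgroup. -/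
noncomputable def distinguished (n : ℕ) (J : Set ℕ) : Finset (Equiv.Perm (Fin n)) :=
  Finset.univ.filter (IsDistinguished J)

theorem mem_distinguished {n : ℕ} {J : Set ℕ} {d : Equiv.Perm (Fin n)} :
    d ∈ distinguished n J ↔ IsDistinguished J d := by simp [distinguished]

open Classical in
/-- The elements of a Young subgroup. -/
noncomputable def youngFinset (n : ℕ) (J : Set ℕ) : Finset (Equiv.Perm (Fin n)) :=
  Finset.univ.filter (· ∈ young n J)

theorem mem_youngFinset {n : ℕ} {J : Set ℕ} {x : Equiv.Perm (Fin n)} :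
    x ∈ youngFinset n J ↔ x ∈ young n J := by simp [youngFinset]

theorem sum_eq_sum_distinguished {n : ℕ} {M : Type*} [AddCommMonoid M] (J : Set ℕ)
    (F : Equiv.Perm (Fin n) → M) :
    ∑ w, F w = ∑ d ∈ distinguished n J, ∑ x ∈ youngFinset n J, F (x * d) := by
  rw [← Finset.sum_product']
  symm
  refine Finset.sum_bij (fun p _ => p.2 * p.1) (fun _ _ => Finset.mem_univ _) ?_ ?_
    (fun _ _ => rfl)
  · rintro ⟨d, x⟩ h ⟨d', x'⟩ h' he
    simp only [Finset.mem_product, mem_distinguished, mem_youngFinset] at h h' he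
    have e : d' = (x'⁻¹ * x) * d := by rw [mul_assoc, he, inv_mul_cancel_left]
    have := h.1.unique (mul_mem (inv_mem h'.2) h.2) (e ▸ h'.1)
    rw [this, one_mul] at e
    rw [inv_mul_eq_one] at this
    rw [e, this]
  · intro w _
    obtain ⟨x, hx, d, hd, rfl⟩ := exists_isDistinguished J w
    exact ⟨(d, x), by simp [mem_distinguished, mem_youngFinset, hx, hd], rfl⟩

theorem rightReps_top_young (n : ℕ) (J : Set ℕ) :
    rightReps ⊤ (young n J) = distinguished n J := by
  ext d
  simp [rightReps, mem_distinguished, isDistinguished_iff]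

theorem rightReps_young_bot (n : ℕ) (J : Set ℕ) :
    rightReps (young n J) ⊥ = youngFinset n J := by
  ext d
  simp [rightReps, mem_youngFinset]

/-! ### Norms and conjugation of parabolic subalgebras -/

/-- If conjugation by the unit `t` matches the parabolic subalgebra of `J` with that of `J'`, and an
element `h` commuting with the former with `h'`, then `h` and `h'` have the same norm. -/
theorem sum_distinguished_conj {n : ℕ} {J J' : Set ℕ} {t h h' : Hecke n} (ht : IsUnit t)
    (c : Equiv.Perm (Fin n) ≃* Equiv.Perm (Fin n))
    (hc : ∀ x, c x ∈ young n J' ↔ x ∈ young n J)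
    (hct : ∀ x ∈ young n J, T x * t = t * T (c x))
    (hcomm : ∀ x ∈ young n J, h * T x = T x * h) (hh : h * t = t * h') :
    ∑ d ∈ distinguished n J, T d⁻¹ * h * T d = ∑ d ∈ distinguished n J', T d⁻¹ * h' * T d := by
  obtain ⟨⟨t, t', htt', ht't⟩, rfl⟩ := ht
  simp only at hct hh ⊢
  have hh' : h' = t' * h * t := by rw [mul_assoc, hh, ← mul_assoc, ht't, one_mul]
  have hct' : ∀ x ∈ young n J, t' * T x = T (c x) * t' := fun x hx => by
    calc t' * T x = t' * (T x * t) * t' := by rw [mul_assoc, mul_assoc, htt', mul_one]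
      _ = _ := by rw [hct x hx, ← mul_assoc t', ht't, one_mul]
  -- Expansion in the basis `T x * T d`, with coefficients read off by the dual basis.
  have expand : ∀ d', t * T d' = ∑ d ∈ distinguished n J, ∑ x ∈ youngFinset n J,
      trace n (T x⁻¹ * (t * T d' * T d⁻¹)) • (T x * T d) := by
    intro d'
    conv_lhs => rw [← sum_trace_smul' (t * T d'), sum_eq_sum_distinguished J]
    refine Finset.sum_congr rfl fun d hd => Finset.sum_congr rfl fun x hx => ?_
    rw [mem_distinguished] at hd
    rw [mem_youngFinset] at hx
    rw [hd.T_mul hx, mul_inv_rev, hd.T_inv_mul_inv hx, mul_assoc, trace_mul_comm (T d⁻¹),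
      mul_assoc (T x⁻¹)]
  -- The same coefficients appear in the opposite expansion: `T d⁻¹ * t` is written in the basis of
  -- all `T w⁻¹`, with `w` factored along `J'`, and then multiplied by `t' = t⁻¹`.
  have dual : ∀ d, ∑ d' ∈ distinguished n J', ∑ x ∈ youngFinset n J,
      trace n (T x⁻¹ * (t * T d' * T d⁻¹)) • (T d'⁻¹ * t' * T x) = T d⁻¹ := by
    intro d
    have h1 : T d⁻¹ = ∑ w, trace n (T w * (T d⁻¹ * t)) • (T w⁻¹ * t') := by
      simp only [← smul_mul_assoc, ← Finset.sum_mul, sum_trace_smul]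
      rw [mul_assoc, htt', mul_one]
    refine Eq.trans ?_ h1.symm
    rw [sum_eq_sum_distinguished J']
    refine Finset.sum_congr rfl fun d' hd => ?_
    rw [mem_distinguished] at hd
    -- The inverse matches the index sets: the term at `y = c x⁻¹` has `T y⁻¹ * t' = t' * T x`,
    -- while its coefficient becomes the one at `x` by cyclicity of the trace.
    refine Finset.sum_bij (fun x _ => c x⁻¹) ?_ ?_ ?_ ?_
    · intro x hx
      rw [mem_youngFinset] at hx ⊢
      rw [hc]
      exact inv_mem hx
    · intro x _ y _ hxy
      simpa using hxy
    · intro y hy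
      rw [mem_youngFinset] at hy
      refine ⟨(c.symm y)⁻¹, ?_, by simp⟩
      rw [mem_youngFinset]
      refine inv_mem ?_
      rw [← hc]
      simpa using hy
    · intro x hx
      rw [mem_youngFinset] at hx
      have hx' : c x⁻¹ ∈ young n J' := (hc _).2 (inv_mem hx)
      rw [hd.T_mul hx', mul_inv_rev, hd.T_inv_mul_inv hx', ← map_inv, inv_inv, mul_assoc (T d'⁻¹),
        hct' x hx, ← mul_assoc (T d'⁻¹), ← mul_assoc (T x⁻¹), ← mul_assoc (T x⁻¹),
        hct _ (inv_mem hx), mul_assoc, mul_assoc, trace_mul_comm t]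
      simp only [mul_assoc]
  calc ∑ d ∈ distinguished n J, T d⁻¹ * h * T d
      = ∑ d ∈ distinguished n J, ∑ d' ∈ distinguished n J', ∑ x ∈ youngFinset n J,
          trace n (T x⁻¹ * (t * T d' * T d⁻¹)) • (T d'⁻¹ * t' * T x * h * T d) := by
        refine Finset.sum_congr rfl fun d _ => ?_
        conv_lhs => rw [← dual d]
        simp only [Finset.sum_mul, smul_mul_assoc]
    _ = ∑ d' ∈ distinguished n J', ∑ d ∈ distinguished n J, ∑ x ∈ youngFinset n J,
          trace n (T x⁻¹ * (t * T d' * T d⁻¹)) • (T d'⁻¹ * t' * h * (T x * T d)) := by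
        rw [Finset.sum_comm]
        refine Finset.sum_congr rfl fun d' _ => Finset.sum_congr rfl fun d _ =>
          Finset.sum_congr rfl fun x hx => ?_
        -- Only here is it used that `h` commutes with the subalgebra of `J`; it lets `T x` join `T
        -- d`.
        rw [mul_assoc _ (T x) h, ← hcomm x (mem_youngFinset.1 hx)]
        simp only [mul_assoc]
    _ = ∑ d ∈ distinguished n J', T d⁻¹ * h' * T d := by
        refine Finset.sum_congr rfl fun d' _ => ?_
        rw [hh', ← mul_assoc, ← mul_assoc, mul_assoc _ t]
        conv_rhs => rw [expand d']
        simp only [Finset.mul_sum, mul_smul_comm]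

/-! ### Jucys–Murphy elements -/

open Classical in
/-- The multiplicative Jucys–Murphy elements of a family `g` of generators with respect to the
parabolic subset `J`. -/
noncomputable def jucysMurphy {R : Type*} [Semiring R] (g : ℕ → R) (J : Set ℕ) : ℕ → R
  | 0 => g 0
  | m + 1 => g (m + 1) + if m ∈ J then g (m + 1) * jucysMurphy g J m * g (m + 1) else 0

/-- A family of elements satisfying the braid relations of type `A`, and quadratic relations for
the indices in `J`. -/
structure IsHeckeFamily {R : Type*} [Semiring R] (g : ℕ → R) (J : Set ℕ) : Prop where
  comm : ∀ i j, i + 2 ≤ j → Commute (g i) (g j)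
  braid : ∀ i, g i * g (i + 1) * g i = g (i + 1) * g i * g (i + 1)
  quad : ∀ j ∈ J, ∃ z : R, (∀ y, Commute z y) ∧ g j * g j = 1 + z * g j

section JucysMurphy

variable {R : Type*} [Semiring R] {g : ℕ → R} {J : Set ℕ}

theorem jucysMurphy_succ_of_mem {m : ℕ} (hm : m ∈ J) :
    jucysMurphy g J (m + 1) = g (m + 1) + g (m + 1) * jucysMurphy g J m * g (m + 1) := by
  rw [jucysMurphy, if_pos hm]

theorem jucysMurphy_succ_of_notMem {m : ℕ} (hm : m ∉ J) :
    jucysMurphy g J (m + 1) = g (m + 1) := by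
  rw [jucysMurphy, if_neg hm, add_zero]

theorem commute_jucysMurphy_of_commute {y : R} {m : ℕ} (hm : m ∈ J)
    (h : ∀ j ∈ J, j ≤ m → Commute y (g j)) : Commute y (jucysMurphy g J m) := by
  induction m with
  | zero => exact h 0 hm le_rfl
  | succ m ih =>
    have h1 := h (m + 1) hm le_rfl
    by_cases hm' : m ∈ J
    · rw [jucysMurphy_succ_of_mem hm']
      exact h1.add_right ((h1.mul_right (ih hm' fun j hj hjm => h j hj (by omega))).mul_right h1)
    · rw [jucysMurphy_succ_of_notMem hm']
      exact h1

theorem IsHeckeFamily.commute_jucysMurphy_of_lt (hg : IsHeckeFamily g J) {m j : ℕ}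
    (h : m + 2 ≤ j) : Commute (g j) (jucysMurphy g J m) := by
  induction m with
  | zero => exact (hg.comm 0 j h).symm
  | succ m ih =>
    have h1 := (hg.comm (m + 1) j h).symm
    by_cases hm' : m ∈ J
    · rw [jucysMurphy_succ_of_mem hm']
      exact h1.add_right ((h1.mul_right (ih (by omega))).mul_right h1)
    · rw [jucysMurphy_succ_of_notMem hm']
      exact h1

/-- By the quadratic relation both products equal `a b + b a + z a b a`. -/
theorem commute_add_conj {a b z : R} (hz : ∀ y, Commute z y) (ha : a * a = 1 + z * a) :
    Commute a (b + a * b * a) := by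
  have e1 : a * (b + a * b * a) = a * b + (b * a + z * (a * b * a)) := by
    rw [mul_add, mul_assoc a b a, ← mul_assoc a a, ha, add_mul, one_mul, mul_assoc z]
  have e2 : (b + a * b * a) * a = b * a + (a * b + z * (a * b * a)) := by
    rw [add_mul, mul_assoc (a * b), ha, mul_add, mul_one, ← mul_assoc, ← (hz (a * b)).eq,
      mul_assoc z]
  rw [Commute, SemiconjBy, e1, e2, add_left_comm]

/-- Write `a = g j`, `b = g (j + 1)` and unfold two levels: `L_{j+1} = b + b a b + b a M a b`, where
`M = L_{j-1}`. Since `b a b = a b a`, the first two terms fall under `commute_add_conj`; the last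
commutes with `a` by two braid moves, as `M` commutes with `b`. At the start of a block the term
with `M` is missing. -/
theorem IsHeckeFamily.commute_jucysMurphy_succ (hg : IsHeckeFamily g J) {j : ℕ} (hj : j ∈ J) :
    Commute (g j) (jucysMurphy g J (j + 1)) := by
  obtain ⟨z, hz, hq⟩ := hg.quad j hj
  rw [jucysMurphy_succ_of_mem hj]
  cases j with
  | zero =>
    rw [jucysMurphy, ← hg.braid 0]
    exact commute_add_conj hz hq
  | succ i =>
    by_cases hi : i ∈ J
    · rw [jucysMurphy_succ_of_mem hi, mul_add, add_mul, ← hg.braid (i + 1), ← add_assoc]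
      refine (commute_add_conj hz hq).add_right ?_
      have hM := (hg.commute_jucysMurphy_of_lt (m := i) (j := i + 2) le_rfl).eq
      generalize jucysMurphy g J i = M at hM
      have hb := hg.braid (i + 1)
      simp only [add_assoc, Nat.reduceAdd] at hb ⊢
      generalize g (i + 1) = a at *
      generalize g (i + 2) = b at *
      rw [Commute, SemiconjBy]
      calc a * (b * (a * M * a) * b) = (a * b * a) * M * (a * b) := by simp only [mul_assoc]
        _ = b * a * (b * M) * (a * b) := by rw [hb]; simp only [mul_assoc]
        _ = b * a * M * (b * a * b) := by rw [hM]; simp only [mul_assoc]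
        _ = b * (a * M * a) * b * a := by rw [← hb]; simp only [mul_assoc]
    · rw [jucysMurphy_succ_of_notMem hi, ← hg.braid (i + 1)]
      exact commute_add_conj hz hq

theorem IsHeckeFamily.commute_jucysMurphy_of_gt (hg : IsHeckeFamily g J) {j m : ℕ} (hj : j ∈ J)
    (h : j < m) : Commute (g j) (jucysMurphy g J m) := by
  induction m, h using Nat.le_induction with
  | base => exact hg.commute_jucysMurphy_succ hj
  | succ m hm ih =>
    have h1 := hg.comm j (m + 1) (by omega)
    by_cases hm' : m ∈ J
    · rw [jucysMurphy_succ_of_mem hm']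
      exact h1.add_right ((h1.mul_right ih).mul_right h1)
    · rw [jucysMurphy_succ_of_notMem hm']
      exact h1

theorem IsHeckeFamily.commute_jucysMurphy_jucysMurphy (hg : IsHeckeFamily g J) {i m : ℕ}
    (hi : i ∈ J) (hm : m ∈ J) : Commute (jucysMurphy g J i) (jucysMurphy g J m) := by
  have main : ∀ {i m : ℕ}, i ∈ J → i < m →
      Commute (jucysMurphy g J i) (jucysMurphy g J m) := fun hi h =>
    (commute_jucysMurphy_of_commute hi fun j hj hji =>
      (hg.commute_jucysMurphy_of_gt hj (by omega)).symm).symm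
  rcases lt_trichotomy i m with h | rfl | h
  · exact main hi h
  · exact Commute.refl _
  · exact (main hm h).symm

/-- The generator `t = g (m + 1)` need not commute with either factor alone. It commutes with the
product because `L_{m+1} = t + t L_m t` commutes with `L_m`. -/
theorem IsHeckeFamily.commute_jucysMurphy_mul (hg : IsHeckeFamily g J) {m : ℕ} (hm : m ∈ J)
    (hm' : m + 1 ∈ J) :
    Commute (g (m + 1)) (jucysMurphy g J m * jucysMurphy g J (m + 1)) := by
  have hc := (hg.commute_jucysMurphy_jucysMurphy hm hm').eq
  rw [jucysMurphy_succ_of_mem hm] at hc ⊢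
  generalize jucysMurphy g J m = L at *
  generalize g (m + 1) = t at *
  rw [Commute, SemiconjBy]
  conv_lhs => rw [hc]
  rw [hc]
  calc t * ((t + t * L * t) * L) = t * (L * (t + t * L * t)) := by rw [hc]
    _ = (t + t * L * t) * L * t := by simp only [mul_add, add_mul, mul_assoc]

open Classical in
/-- The product, in increasing order of index, of the `f j` with `j ∈ J` and `j < N`. -/
noncomputable def orderedProd (f : ℕ → R) (J : Set ℕ) (N : ℕ) : R :=
  (((List.range N).filter (· ∈ J)).map f).prod

theorem orderedProd_succ_of_mem {f : ℕ → R} {N : ℕ} (h : N ∈ J) :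
    orderedProd f J (N + 1) = orderedProd f J N * f N := by
  simp [orderedProd, List.range_succ, h]

theorem orderedProd_succ_of_notMem {f : ℕ → R} {N : ℕ} (h : N ∉ J) :
    orderedProd f J (N + 1) = orderedProd f J N := by
  simp [orderedProd, List.range_succ, h]

theorem commute_orderedProd {f : ℕ → R} {y : R} {N : ℕ}
    (h : ∀ m ∈ J, m < N → Commute y (f m)) : Commute y (orderedProd f J N) := by
  induction N with
  | zero => exact Commute.one_right y
  | succ N ih =>
    have := ih fun m hm hmN => h m hm (by omega)
    by_cases hN : N ∈ J
    · rw [orderedProd_succ_of_mem hN]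
      exact this.mul_right (h N hN (by omega))
    · rwa [orderedProd_succ_of_notMem hN]

/-- Factors with index above `j` or below `j - 1` commute with `g j` individually; those at `j - 1`
and `j` do so as a pair. If `j - 1 ∉ J`, the factor at `j` is `g j` itself. -/
theorem IsHeckeFamily.commute_orderedProd_jucysMurphy (hg : IsHeckeFamily g J) {j N : ℕ}
    (hj : j ∈ J) (h : j < N) : Commute (g j) (orderedProd (jucysMurphy g J) J N) := by
  induction N, h using Nat.le_induction with
  | base =>
    rw [Nat.succ_eq_add_one, orderedProd_succ_of_mem hj]
    cases j with
    | zero => simp [orderedProd, jucysMurphy]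
    | succ i =>
      have hP : Commute (g (i + 1)) (orderedProd (jucysMurphy g J) J i) :=
        commute_orderedProd fun m _ hm => hg.commute_jucysMurphy_of_lt (by omega)
      by_cases hi : i ∈ J
      · rw [orderedProd_succ_of_mem hi, mul_assoc]
        exact hP.mul_right (hg.commute_jucysMurphy_mul hi hj)
      · rw [orderedProd_succ_of_notMem hi, jucysMurphy_succ_of_notMem hi]
        exact hP.mul_right (Commute.refl _)
  | succ N hN ih =>
    by_cases hN' : N ∈ J
    · rw [orderedProd_succ_of_mem hN']
      exact ih.mul_right (hg.commute_jucysMurphy_of_gt hj (by omega))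
    · rwa [orderedProd_succ_of_notMem hN']

open Classical in
/-- The sum of the conjugates of `y` by `1, g (q - 1), g (q - 1) * g (q - 2), …`, as long as the
indices stay in `J`. -/
noncomputable def descendingSum (g : ℕ → R) (J : Set ℕ) : ℕ → R → R
  | 0, y => y
  | q + 1, y => y + if q ∈ J then descendingSum g J q (g q * y * g q) else 0

theorem descendingSum_mul {q : ℕ} {a b : R} (ha : ∀ r ∈ J, r < q → Commute a (g r))
    (hb : ∀ r ∈ J, r < q → Commute b (g r)) (y : R) :
    descendingSum g J q (a * y * b) = a * descendingSum g J q y * b := by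
  induction q generalizing y with
  | zero => rfl
  | succ q ih =>
    rw [descendingSum, descendingSum]
    by_cases hq : q ∈ J
    · rw [if_pos hq, if_pos hq, mul_add, add_mul,
        ← ih (fun r hr hrq => ha r hr (by omega)) (fun r hr hrq => hb r hr (by omega))]
      have e1 := (ha q hq (by omega)).eq
      have e2 := (hb q hq (by omega)).eq
      congr 2
      calc g q * (a * y * b) * g q = (g q * a) * y * (b * g q) := by simp only [mul_assoc]
        _ = _ := by rw [← e1, e2]; simp only [mul_assoc]
    · simp [hq]

/-- The braid relation turns `g q * g (q + 1) * g q` into `g (q + 1) * g q * g (q + 1)`, whose outer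
factors can be pulled out of the remaining sum. This is the recursion of `jucysMurphy`. -/
theorem IsHeckeFamily.descendingSum_self (hg : IsHeckeFamily g J) (q : ℕ) :
    descendingSum g J q (g q) = jucysMurphy g J q := by
  induction q with
  | zero => rfl
  | succ q ih =>
    rw [descendingSum, jucysMurphy]
    by_cases hq : q ∈ J
    · have hc : ∀ r ∈ J, r < q → Commute (g (q + 1)) (g r) := fun r _ hr =>
        (hg.comm r (q + 1) (by omega)).symm
      rw [if_pos hq, if_pos hq, hg.braid, descendingSum_mul hc hc, ih]
    · rw [if_neg hq, if_neg hq]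

end JucysMurphy

/-! ### The Coxeter class elements as products of Jucys–Murphy elements -/

/-- The generators of the Hecke algebra, extended by zero to a family indexed by `ℕ`. -/
noncomputable def genNat (n : ℕ) (j : ℕ) : Hecke n := if h : j < n - 1 then gen ⟨j, h⟩ else 0

theorem genNat_val {n : ℕ} (i : Fin (n - 1)) : genNat n i = gen i := by simp [genNat]

theorem genNat_of_lt {n j : ℕ} (h : j < n - 1) : genNat n j = gen ⟨j, h⟩ := dif_pos h

theorem genNat_of_not_lt {n j : ℕ} (h : ¬j < n - 1) : genNat n j = 0 := dif_neg h

/-- Extension by zero preserves the homogeneous relations but not the quadratic one, hence the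
restriction of the latter to `J`. -/
theorem isHeckeFamily_genNat {n : ℕ} {J : Set ℕ} (hJ : ∀ j ∈ J, j < n - 1) :
    IsHeckeFamily (genNat n) J where
  comm i j h := by
    by_cases hj : j < n - 1
    · rw [genNat_of_lt hj, genNat_of_lt (show i < n - 1 by omega)]
      exact gen_comm h
    · rw [genNat_of_not_lt hj]
      exact Commute.zero_right _
  braid i := by
    by_cases hj : i + 1 < n - 1
    · rw [genNat_of_lt hj, genNat_of_lt (show i < n - 1 by omega)]
      exact gen_braid rfl
    · rw [genNat_of_not_lt hj]
      simp
  quad j hj := by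
    refine ⟨algebraMap ℤ[X] (Hecke n) X, fun y => Algebra.commutes _ _, ?_⟩
    rw [genNat_of_lt (hJ j hj), gen_sq, Algebra.smul_def]

theorem commute_T_of_mem_young {n : ℕ} {J : Set ℕ} {y : Hecke n}
    (hy : ∀ j ∈ J, Commute y (genNat n j)) {x : Equiv.Perm (Fin n)} (hx : x ∈ young n J) :
    Commute y (T x) := by
  refine young_induction (J := J) (P := fun x => Commute y (T x)) (by simp)
    (fun x i hx hi' h ih => ?_) hx
  rw [T_simpleRefl_mul h]
  exact (genNat_val i ▸ hy i hi').mul_right ih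

/-- The indices of `J` which are less than `N - 1` and followed by an index of `J`. -/
def innerIndices (J : Set ℕ) (N : ℕ) : Set ℕ := {j | j ∈ J ∧ j + 1 ∈ J ∧ j + 1 < N}

theorem mem_innerIndices {J : Set ℕ} {N j : ℕ} :
    j ∈ innerIndices J N ↔ j ∈ J ∧ j + 1 ∈ J ∧ j + 1 < N := Iff.rfl

/-- The norm from the trivial subgroup to a Young subgroup. -/
noncomputable def youngNorm {n : ℕ} (J : Set ℕ) (h : Hecke n) : Hecke n :=
  ∑ x ∈ youngFinset n J, T x⁻¹ * h * T x

theorem youngNorm_mul_of_commute {n : ℕ} {J : Set ℕ} {y : Hecke n}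
    (hy : ∀ j ∈ J, Commute y (genNat n j)) (h : Hecke n) :
    youngNorm J (h * y) = youngNorm J h * y := by
  rw [youngNorm, youngNorm, Finset.sum_mul]
  refine Finset.sum_congr rfl fun x hx => ?_
  have := (commute_T_of_mem_young hy (mem_youngFinset.1 hx)).eq
  rw [← mul_assoc, mul_assoc _ y, this, ← mul_assoc]

open Classical in
-- Elements `x` of the larger Young subgroup are sorted by `q = x⁻¹ N`. Right multiplication by
-- `s_q` maps the class `q + 1` onto the class `q` and raises lengths by one, conjugating the
-- partial norm by `g q`. The class `q = N` is the smaller Young subgroup.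
theorem youngNorm_eq_descendingSum {n : ℕ} {J : Set ℕ} {N : ℕ} (hN : N ∈ J) (hn : N < n - 1)
    (y : Hecke n) :
    youngNorm (innerIndices J (N + 1)) y =
      descendingSum (genNat n) J N (youngNorm (innerIndices J N) y) := by
  set K := innerIndices J (N + 1) with hK
  have hNK : N ∉ K := fun h => by have := h.2.2; omega
  set p : Fin n := ⟨N, by omega⟩ with hp
  have hle : ∀ x ∈ young n K, ((x⁻¹ p : Fin n) : ℕ) ≤ N := fun x hx =>
    (inv_mem hx N hNK p).2 le_rfl
  have partial_sum : ∀ q, q ∈ J → q ≤ N →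
      ∑ x ∈ (youngFinset n K).filter (fun x => ((x⁻¹ p : Fin n) : ℕ) ≤ q), T x⁻¹ * y * T x =
        descendingSum (genNat n) J q
          (∑ x ∈ (youngFinset n K).filter (fun x => ((x⁻¹ p : Fin n) : ℕ) = q),
            T x⁻¹ * y * T x) := by
    intro q
    induction q with
    | zero =>
      intro _ _
      simp only [Nat.le_zero, descendingSum]
    | succ q ih =>
      intro hq hqN
      have hsplit : (youngFinset n K).filter (fun x => ((x⁻¹ p : Fin n) : ℕ) ≤ q + 1) =
          (youngFinset n K).filter (fun x => ((x⁻¹ p : Fin n) : ℕ) = q + 1) ∪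
          (youngFinset n K).filter (fun x => ((x⁻¹ p : Fin n) : ℕ) ≤ q) := by
        rw [← Finset.filter_or]
        refine Finset.filter_congr fun x _ => ?_
        omega
      have hdisj : Disjoint
          ((youngFinset n K).filter (fun x => ((x⁻¹ p : Fin n) : ℕ) = q + 1))
          ((youngFinset n K).filter (fun x => ((x⁻¹ p : Fin n) : ℕ) ≤ q)) :=
        Finset.disjoint_filter.2 fun x _ h1 h2 => by omega
      rw [hsplit, Finset.sum_union hdisj, descendingSum]
      congr 1
      by_cases hqJ : q ∈ J
      · rw [if_pos hqJ, ih hqJ (by omega)]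
        congr 1
        have hqn : q < n - 1 := by omega
        rw [genNat_of_lt hqn, Finset.mul_sum, Finset.sum_mul]
        have hqK : q ∈ K := ⟨hqJ, hq, by omega⟩
        set i : Fin (n - 1) := ⟨q, hqn⟩ with hi'
        have hs : simpleRefl i ∈ young n K := simpleRefl_mem_young hqK
        symm
        refine Finset.sum_bij (fun x _ => x * simpleRefl i) ?_ ?_ ?_ ?_
        · intro x hx
          rw [Finset.mem_filter, mem_youngFinset] at hx ⊢
          refine ⟨mul_mem hx.1 hs, ?_⟩
          have : x⁻¹ p = hi i := Fin.ext hx.2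
          rw [mul_inv_rev, simpleRefl_inv, Equiv.Perm.mul_apply, this, simpleRefl_hi]
          rfl
        · intro a _ b _ h
          exact mul_right_cancel h
        · intro x hx
          rw [Finset.mem_filter, mem_youngFinset] at hx
          refine ⟨x * simpleRefl i, ?_, by simp⟩
          rw [Finset.mem_filter, mem_youngFinset]
          refine ⟨mul_mem hx.1 hs, ?_⟩
          have : x⁻¹ p = lo i := Fin.ext hx.2
          rw [mul_inv_rev, simpleRefl_inv, Equiv.Perm.mul_apply, this, simpleRefl_lo]
          rfl
        · intro x hx
          rw [Finset.mem_filter, mem_youngFinset] at hx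
          have h1 : x⁻¹ p = hi i := Fin.ext hx.2
          have h2 : x (hi i) = p := by rw [← h1]; simp
          have hlt : x (lo i) < x (hi i) := by
            refine lt_of_le_of_ne ?_ fun h => lo_ne_hi i (x.injective h)
            rw [h2]
            exact (hx.1 N hNK (lo i)).2 (by simp [hi']; omega)
          rw [mul_inv_rev, simpleRefl_inv, T_mul_simpleRefl hlt,
            T_simpleRefl_mul (by simpa using hlt)]
          simp only [mul_assoc]
      -- If `q ∉ J`, every `x` preserves `{0, …, q}`, so `x⁻¹ N ≤ q` is impossible and the sum
      -- stops.
      · rw [if_neg hqJ]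
        refine Finset.sum_eq_zero fun x hx => ?_
        rw [Finset.mem_filter, mem_youngFinset] at hx
        have := (inv_mem hx.1 q (fun h => hqJ h.1) p).1 hx.2
        simp only [hp] at this
        omega
  have h1 := partial_sum N hN le_rfl
  rw [Finset.filter_true_of_mem fun x hx => hle x (mem_youngFinset.1 hx)] at h1
  rw [youngNorm, h1, youngNorm]
  congr 2
  -- Lowering the bound from `N + 1` to `N` removes at most the index `N - 1`, which amounts to
  -- requiring that `x` fix `N`.
  ext x
  rw [Finset.mem_filter, mem_youngFinset, mem_youngFinset]
  constructor
  · rintro ⟨hx, hxp⟩ j hj a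
    have hpx : x p = p := by
      have : x⁻¹ p = p := Fin.ext hxp
      conv_lhs => rw [← this]
      simp
    by_cases hjN : j + 1 = N
    · have h2 := hx N hNK a
      have h3 : (x a : ℕ) = N ↔ (a : ℕ) = N := by
        rw [show N = (p : ℕ) from rfl, Fin.val_inj, Fin.val_inj]
        conv_lhs => rw [← hpx]
        exact x.injective.eq_iff
      omega
    · exact hx j (fun h => hj ⟨h.1, h.2.1, by have := h.2.2; omega⟩) a
  · intro hx
    refine ⟨fun j hj a => hx j (fun h => hj ⟨h.1, h.2.1, by have := h.2.2; omega⟩) a, ?_⟩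
    have h2 := inv_mem hx N (fun h => by have := h.2.2; omega) p
    rcases Nat.eq_zero_or_pos N with h0 | h0
    · simp only [hp] at h2 ⊢
      omega
    · have h3 := inv_mem hx (N - 1) (fun h => by have := h.2.2; omega) p
      simp only [hp] at h2 h3 ⊢
      omega

/-- Induction on `N`. The new factor `g N` commutes with the smaller Young subalgebra, so it leaves
the inner norm; the product `∏ L_m` over `m < N` commutes with the earlier generators, so it leaves
the descending sum, and what is left there is `L_N`. -/
theorem youngNorm_orderedProd {n : ℕ} {J : Set ℕ} (hJ : ∀ j ∈ J, j < n - 1) (N : ℕ) :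
    youngNorm (innerIndices J N) (orderedProd (genNat n) J N) =
      orderedProd (jucysMurphy (genNat n) J) J N := by
  have hg := isHeckeFamily_genNat hJ
  induction N with
  | zero =>
    have : youngFinset n (innerIndices J 0) = {1} := by
      ext x
      rw [mem_youngFinset, Finset.mem_singleton]
      constructor
      · intro hx
        refine young_induction (J := innerIndices J 0) (P := fun x => x = 1) rfl
          (fun x i _ h => absurd h.2.2 (by omega)) hx
      · rintro rfl
        exact one_mem _
    rw [youngNorm, this]
    simp [orderedProd]
  | succ N ih =>
    by_cases hN : N ∈ J
    · rw [youngNorm_eq_descendingSum hN (hJ N hN), orderedProd_succ_of_mem hN,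
        orderedProd_succ_of_mem hN, youngNorm_mul_of_commute, ih]
      · have := descendingSum_mul (g := genNat n) (J := J) (q := N)
          (a := orderedProd (jucysMurphy (genNat n) J) J N) (b := 1)
          (fun r hr hrN => (hg.commute_orderedProd_jucysMurphy hr hrN).symm)
          (fun r _ _ => Commute.one_left _) (genNat n N)
        rw [mul_one, mul_one, hg.descendingSum_self] at this
        exact this
      · intro j hj
        exact (hg.comm j N (by have := hj.2.2; omega)).symm
    · have : innerIndices J (N + 1) = innerIndices J N := by
        ext j
        rw [mem_innerIndices, mem_innerIndices]
        constructor
        · rintro ⟨h1, h2, h3⟩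
          have : j + 1 ≠ N := fun h => hN (h ▸ h2)
          exact ⟨h1, h2, by omega⟩
        · rintro ⟨h1, h2, h3⟩
          exact ⟨h1, h2, by omega⟩
      rw [this, orderedProd_succ_of_notMem hN, orderedProd_succ_of_notMem hN, ih]

/-- Increasing words are reduced: the letters before `i` fix every point above `i`, so appending `i`
creates an inversion. -/
theorem T_wordProd_of_pairwise_lt {n : ℕ} {l : List (Fin (n - 1))} (h : l.Pairwise (· < ·)) :
    T (wordProd l) = (l.map gen).prod := by
  induction l using List.reverseRecOn with
  | nil => simp [wordProd_nil]
  | append_singleton l i ih =>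
    rw [List.pairwise_append] at h
    have hl : ∀ j ∈ l, j < i := fun j hj => h.2.2 j hj i (by simp)
    have hfix : ∀ k : List (Fin (n - 1)), (∀ j ∈ k, j < i) →
        ∀ a : Fin n, (i : ℕ) + 1 ≤ a → wordProd k a = a := by
      intro k hk a ha
      induction k with
      | nil => rfl
      | cons j k ihk =>
        have hj : j < i := hk j (by simp)
        rw [Fin.lt_def] at hj
        rw [wordProd_cons, Equiv.Perm.mul_apply, ihk fun j hj => hk j (by simp [hj]),
          simpleRefl_of_ne (by omega) (by omega)]
    have hlt : wordProd l (lo i) < wordProd l (hi i) := by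
      refine (lt_or_gt_lo_hi _ i).resolve_right fun hgt => ?_
      have h1 := hfix l hl (hi i) (by simp)
      rw [h1, Fin.lt_def, hi_val] at hgt
      have h2 := (wordProd l).injective (hfix l hl _ hgt.le)
      rw [h2, lo_val] at hgt
      omega
    rw [wordProd_append, wordProd_cons, wordProd_nil, mul_one, T_mul_simpleRefl hlt, ih h.1]
    simp

/-- The indices of the simple reflections in the parabolic subgroup of a composition. -/
def simpleIndices {n : ℕ} (c : Composition n) : Set ℕ :=
  {j | ∃ h : j < n - 1, IsSimpleOf c ⟨j, h⟩}

theorem val_mem_simpleIndices {n : ℕ} {c : Composition n} {i : Fin (n - 1)} :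
    (i : ℕ) ∈ simpleIndices c ↔ IsSimpleOf c i := ⟨fun ⟨_, h⟩ => h, fun h => ⟨i.2, h⟩⟩

theorem lt_of_mem_simpleIndices {n : ℕ} (c : Composition n) : ∀ j ∈ simpleIndices c, j < n - 1 :=
  fun _ h => h.1

theorem parabolic_eq_young {n : ℕ} (c : Composition n) :
    parabolic c = young n (simpleIndices c) := by
  rw [young_eq_closure, parabolic]
  simp only [val_mem_simpleIndices]

theorem T_coxeterElt {n : ℕ} (c : Composition n) :
    T (coxeterElt c) = orderedProd (genNat n) (simpleIndices c) (n - 1) := by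
  classical
  rw [coxeterElt, T_wordProd_of_pairwise_lt, orderedProd, ← List.map_coe_finRange_eq_range,
    List.filter_map, List.map_map]
  · congr 1
    have : (genNat n ∘ fun i : Fin (n - 1) => (i : ℕ)) = gen := funext genNat_val
    rw [this]
    congr 1
    refine List.filter_congr fun i _ => ?_
    simp [val_mem_simpleIndices]
  · exact (List.pairwise_lt_finRange _).filter _

theorem eta_eq {n : ℕ} (c : Composition n)
    (h : simpleIndices (subOne c) = innerIndices (simpleIndices c) (n - 1)) :
    eta c = orderedProd (jucysMurphy (genNat n) (simpleIndices c)) (simpleIndices c) (n - 1) := by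
  rw [← youngNorm_orderedProd (lt_of_mem_simpleIndices c), eta, relNorm, parabolic_eq_young,
    rightReps_young_bot, youngNorm, T_coxeterElt, h]

/-! ### Compositions -/

/-- `x` is the sum of an initial segment of `l`. -/
def IsPartialSum : List ℕ → ℕ → Prop
  | [], x => x = 0
  | a :: l, x => x = 0 ∨ a ≤ x ∧ IsPartialSum l (x - a)

theorem isPartialSum_zero (l : List ℕ) : IsPartialSum l 0 := by
  cases l <;> simp [IsPartialSum]

theorem isPartialSum_sum (l : List ℕ) : IsPartialSum l l.sum := by
  induction l with
  | nil => rfl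
  | cons a l ih => exact Or.inr ⟨by simp, by simpa using ih⟩

theorem exists_mem_block_iff (l : List ℕ) (j : ℕ) :
    (∃ i < l.length, (l.take i).sum ≤ j ∧ j + 1 < (l.take (i + 1)).sum) ↔
      j + 1 < l.sum ∧ ¬IsPartialSum l (j + 1) := by
  induction l generalizing j with
  | nil => simp
  | cons a l ih =>
    simp only [IsPartialSum, List.sum_cons, List.length_cons]
    by_cases haj : a ≤ j + 1
    · by_cases haj' : a = j + 1
      · subst haj'
        simp only [le_refl, Nat.sub_self, isPartialSum_zero, and_self, or_true, not_true,
          and_false, iff_false]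
        rintro ⟨i, hi, h1, h2⟩
        cases i with
        | zero => simp at h2
        | succ i => simp at h1; omega
      · have hj : j - a + 1 = j + 1 - a := by omega
        have hs : j + 1 < a + l.sum ↔ j + 1 - a < l.sum := by omega
        have := ih (j - a)
        rw [hj] at this
        simp only [Nat.add_eq_zero_iff, one_ne_zero, and_false, false_or, haj, true_and]
        rw [hs, ← this]
        clear this
        constructor
        · rintro ⟨i, hi, h1, h2⟩
          cases i with
          | zero => simp at h2; omega
          | succ i =>
            simp only [List.take_succ_cons, List.sum_cons] at h1 h2
            exact ⟨i, by omega, by omega, by omega⟩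
        · rintro ⟨i, hi, h1, h2⟩
          refine ⟨i + 1, by omega, ?_, ?_⟩ <;> simp only [List.take_succ_cons, List.sum_cons] <;>
            omega
    · simp only [Nat.add_eq_zero_iff, one_ne_zero, and_false, haj, false_and, or_self,
        not_false_eq_true, and_true]
      refine ⟨fun _ => by omega, fun _ => ⟨0, by omega, by simp, by simp; omega⟩⟩

/-- Splitting off a final `1` adds a cut one place before the end of each block. For a block of size
`1` that cut is already present. -/
theorem isPartialSum_flatMap_splitOne (l : List ℕ) (hl : ∀ a ∈ l, 0 < a) (x : ℕ) :
    IsPartialSum (l.flatMap splitOne) (x + 1) ↔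
      IsPartialSum l (x + 1) ∨ IsPartialSum l (x + 2) := by
  induction l generalizing x with
  | nil => simp [IsPartialSum]
  | cons a l ih =>
    have ha := hl a (by simp)
    have ih := ih fun a ha => hl a (by simp [ha])
    have h0 := isPartialSum_zero (l.flatMap splitOne)
    have h0' := isPartialSum_zero l
    rw [List.flatMap_cons, splitOne]
    split_ifs with h1
    · simp only [List.cons_append, List.nil_append, IsPartialSum, Nat.add_eq_zero_iff, one_ne_zero,
        OfNat.ofNat_ne_zero, and_false, false_or]
      rcases lt_trichotomy (x + 2) a with h | h | h
      · constructor
        · rintro ⟨h, -⟩; omega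
        · rintro (⟨h, -⟩ | ⟨h, -⟩) <;> omega
      · subst h
        simp [h0']
      · by_cases h' : x + 1 = a
        · subst h'
          simp [h0, h0']
        · obtain ⟨y, rfl⟩ : ∃ y, x = a + y := ⟨x - a, by omega⟩
          have := ih y
          rw [show a + y + 1 - (a - 1) - 1 = y + 1 by omega, show a + y + 1 - a = y + 1 by omega,
            show a + y + 2 - a = y + 2 by omega, this]
          constructor
          · rintro ⟨-, h | ⟨-, h⟩⟩
            · omega
            · exact h.imp (fun h => ⟨by omega, h⟩) fun h => ⟨by omega, h⟩
          · intro h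
            exact ⟨by omega, Or.inr ⟨by omega, h.imp (fun h => h.2) fun h => h.2⟩⟩
    · obtain rfl : a = 1 := by omega
      simp only [List.cons_append, List.nil_append, IsPartialSum, Nat.add_eq_zero_iff, one_ne_zero,
        OfNat.ofNat_ne_zero, and_false, false_or]
      cases x with
      | zero => simp [h0, h0']
      | succ x =>
        have := ih x
        simp only [Nat.add_sub_cancel, show x + 1 + 2 - 1 = x + 2 by omega] at this ⊢
        rw [this]
        constructor
        · rintro ⟨-, h⟩
          exact h.imp (fun h => ⟨by omega, h⟩) fun h => ⟨by omega, h⟩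
        · intro h
          exact ⟨by omega, h.imp (fun h => h.2) fun h => h.2⟩

theorem mem_simpleIndices_iff {n : ℕ} (c : Composition n) (j : ℕ) :
    j ∈ simpleIndices c ↔ j + 1 < n ∧ ¬IsPartialSum c.blocks (j + 1) := by
  have := exists_mem_block_iff c.blocks j
  rw [c.blocks_sum] at this
  rw [← this]
  constructor
  · rintro ⟨h, h'⟩
    exact h'
  · intro h
    exact ⟨by have := (this.1 h).1; omega, h⟩

theorem simpleIndices_subOne {n : ℕ} (c : Composition n) :
    simpleIndices (subOne c) = innerIndices (simpleIndices c) (n - 1) := by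
  ext j
  have h1 := isPartialSum_flatMap_splitOne c.blocks (fun a ha => c.blocks_pos ha) j
  have h2 := isPartialSum_sum c.blocks
  rw [c.blocks_sum] at h2
  rw [mem_innerIndices, mem_simpleIndices_iff, mem_simpleIndices_iff, mem_simpleIndices_iff,
    show (subOne c).blocks = c.blocks.flatMap splitOne from rfl, h1, not_or]
  constructor
  · rintro ⟨h3, h4, h5⟩
    -- Since `n` is itself a partial sum, a position `j + 2 ≤ n` that is not a cut lies strictly
    -- below `n`.
    have : j + 2 ≠ n := fun h => h5 (h ▸ h2)
    exact ⟨⟨h3, h4⟩, ⟨by omega, h5⟩, by omega⟩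
  · rintro ⟨⟨h3, h4⟩, ⟨_, h5⟩, -⟩
    exact ⟨h3, h4, h5⟩

/-- Repeated components leave the matching of blocks undetermined; any one choice is enough. -/
theorem exists_equiv_of_perm {α : Type*} {l l' : List α} (h : l.Perm l') :
    ∃ e : Fin l.length ≃ Fin l'.length, ∀ i, l'.get (e i) = l.get i := by
  induction h with
  | nil => exact ⟨Equiv.refl _, fun _ => rfl⟩
  | cons x _ ih =>
    obtain ⟨e, he⟩ := ih
    refine ⟨(finSuccEquiv _).trans ((Equiv.optionCongr e).trans (finSuccEquiv _).symm),
      fun i => ?_⟩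
    refine Fin.cases ?_ (fun i => ?_) i
    · simp
    · simpa using he i
  | swap x y l =>
    refine ⟨Equiv.swap 0 1, fun i => ?_⟩
    refine Fin.cases ?_ (fun i => Fin.cases ?_ (fun i => ?_) i) i
    · rw [Equiv.swap_apply_left]; rfl
    · rw [show (Fin.succ 0 : Fin (l.length + 1 + 1)) = 1 from rfl, Equiv.swap_apply_right]; rfl
    · have : Equiv.swap (0 : Fin (l.length + 2)) 1 i.succ.succ = i.succ.succ :=
        Equiv.swap_apply_of_ne_of_ne (Fin.succ_ne_zero _)
          fun h => Fin.succ_ne_zero i (Fin.succ_injective _ h)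
      exact congrArg (x :: y :: l).get this
  | trans _ _ ih₁ ih₂ =>
    obtain ⟨e₁, h₁⟩ := ih₁
    obtain ⟨e₂, h₂⟩ := ih₂
    exact ⟨e₁.trans e₂, fun i => by rw [Equiv.trans_apply, h₂, h₁]⟩

/-- The permutation `σ` maps the consecutive positions `j`, `j + 1` with `j ∈ J` to consecutive
positions `k`, `k + 1` with `k ∈ J'`. -/
def MapsSimple {n : ℕ} (σ : Equiv.Perm (Fin n)) (J J' : Set ℕ) : Prop :=
  ∀ i : Fin (n - 1), (i : ℕ) ∈ J →
    ∃ k : Fin (n - 1), (k : ℕ) ∈ J' ∧ σ (lo i) = lo k ∧ σ (hi i) = hi k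

theorem exists_embedding_of_isSimpleOf {n : ℕ} {c : Composition n} {i : Fin (n - 1)}
    (h : IsSimpleOf c i) : ∃ (b : Fin c.length) (k : ℕ) (hk : k + 1 < c.blocksFun b),
      lo i = c.embedding b ⟨k, by omega⟩ ∧ hi i = c.embedding b ⟨k + 1, hk⟩ := by
  obtain ⟨b, hb, h1, h2⟩ := h
  have := c.sizeUpTo_succ' ⟨b, hb⟩
  simp only at this
  refine ⟨⟨b, hb⟩, i - c.sizeUpTo b, by omega, Fin.ext ?_, Fin.ext ?_⟩
  · simp only [lo_val, Composition.coe_embedding]; omega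
  · simp only [hi_val, Composition.coe_embedding]; omega

theorem mapsSimple_of_embedding {n : ℕ} {α β : Composition n} {σ : Equiv.Perm (Fin n)}
    {e : Fin α.length → Fin β.length} (he : ∀ b, α.blocksFun b = β.blocksFun (e b))
    (hσ : ∀ b k, (σ (α.embedding b k) : ℕ) = β.sizeUpTo (e b) + k) :
    MapsSimple σ (simpleIndices α) (simpleIndices β) := by
  intro i hi'
  obtain ⟨b, k, hk, h1, h2⟩ := exists_embedding_of_isSimpleOf (val_mem_simpleIndices.1 hi')
  have e1 := hσ b ⟨k, by omega⟩
  have e2 := hσ b ⟨k + 1, hk⟩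
  rw [← h1] at e1
  rw [← h2] at e2
  simp only at e1 e2
  have hlt := (σ (hi i)).2
  have hs := β.sizeUpTo_succ' (e b)
  have hb := he b
  refine ⟨⟨σ (lo i), by omega⟩, val_mem_simpleIndices.2 ⟨e b, (e b).2, ?_, ?_⟩, rfl,
    Fin.ext ?_⟩
  · simp only; omega
  · simp only; omega
  · simp only [hi_val]; omega

theorem exists_mapsSimple {n : ℕ} {α β : Composition n} (h : Conjugate α β) :
    ∃ σ : Equiv.Perm (Fin n), MapsSimple σ (simpleIndices α) (simpleIndices β) ∧
      MapsSimple σ⁻¹ (simpleIndices β) (simpleIndices α) := by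
  obtain ⟨e, he⟩ := exists_equiv_of_perm h
  have he' : ∀ b : Fin α.length, α.blocksFun b = β.blocksFun (e b) := fun b => (he b).symm
  have he'' : ∀ b : Fin β.length, β.blocksFun b = α.blocksFun (e.symm b) := fun b => by
    rw [he' (e.symm b), Equiv.apply_symm_apply]
  let σ : Equiv.Perm (Fin n) := α.blocksFinEquiv.symm.trans
    ((Equiv.sigmaCongr e fun b => finCongr (he' b)).trans β.blocksFinEquiv)
  have hσ : ∀ b k, σ (α.embedding b k) = β.embedding (e b) (Fin.cast (he' b) k) := by
    intro b k
    rw [show α.embedding b k = α.blocksFinEquiv ⟨b, k⟩ from rfl]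
    simp only [σ, Equiv.trans_apply, Equiv.symm_apply_apply]
    rfl
  refine ⟨σ, mapsSimple_of_embedding he' fun b k => ?_, mapsSimple_of_embedding he'' fun b k => ?_⟩
  · rw [hσ, Composition.coe_embedding]
    rfl
  · obtain ⟨b, rfl⟩ := e.surjective b
    have hk : β.embedding (e b) k = σ (α.embedding b (Fin.cast (he' b).symm k)) := by
      rw [hσ]; rfl
    rw [hk, show σ⁻¹ (σ _) = _ from σ.symm_apply_apply _, Composition.coe_embedding, Equiv.symm_apply_apply]
    rfl

/-! ### Conjugation of the Coxeter class elements -/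

theorem T_simpleRefl {n : ℕ} (i : Fin (n - 1)) : T (simpleRefl i) = gen i := by
  have := T_simpleRefl_mul (w := 1) (i := i) (by simp [Fin.lt_def])
  simpa using this

theorem MapsSimple.isDistinguished {n : ℕ} {σ : Equiv.Perm (Fin n)} {J J' : Set ℕ}
    (h : MapsSimple σ J J') : IsDistinguished J σ⁻¹ := by
  intro i hi'
  obtain ⟨k, -, h1, h2⟩ := h i hi'
  rw [inv_inv, h1, h2]
  simp [Fin.lt_def]

theorem MapsSimple.conj_simpleRefl {n : ℕ} {σ : Equiv.Perm (Fin n)} {J J' : Set ℕ}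
    (h : MapsSimple σ J J') {i : Fin (n - 1)} (hi' : (i : ℕ) ∈ J) :
    ∃ k : Fin (n - 1), (k : ℕ) ∈ J' ∧ (k : ℕ) = σ (lo i) ∧
      MulAut.conj σ (simpleRefl i) = simpleRefl k := by
  obtain ⟨k, hk, h1, h2⟩ := h i hi'
  refine ⟨k, hk, by rw [h1]; rfl, ?_⟩
  rw [MulAut.conj_apply, simpleRefl_eq, simpleRefl_eq, ← Equiv.swap_apply_apply, h1, h2]

theorem MapsSimple.conj_mem {n : ℕ} {σ : Equiv.Perm (Fin n)} {J J' : Set ℕ}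
    (h : MapsSimple σ J J') {x : Equiv.Perm (Fin n)} (hx : x ∈ young n J) :
    MulAut.conj σ x ∈ young n J' := by
  refine young_induction (J := J) (P := fun x => MulAut.conj σ x ∈ young n J') (by simp)
    (fun x i _ hi' _ ih => ?_) hx
  obtain ⟨k, hk, -, e⟩ := h.conj_simpleRefl hi'
  rw [map_mul, e]
  exact mul_mem (simpleRefl_mem_young hk) ih

/-- Both factorizations of `x σ⁻¹ = σ⁻¹ (σ x σ⁻¹)` are length-additive: `σ⁻¹` is distinguished for
`J`, and `σ` for `J'`. -/
theorem MapsSimple.T_mul_T_inv {n : ℕ} {σ : Equiv.Perm (Fin n)} {J J' : Set ℕ}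
    (h : MapsSimple σ J J') (h' : MapsSimple σ⁻¹ J' J) {x : Equiv.Perm (Fin n)}
    (hx : x ∈ young n J) : T x * T σ⁻¹ = T σ⁻¹ * T (MulAut.conj σ x) := by
  rw [← h.isDistinguished.T_mul hx]
  have := h'.isDistinguished.T_inv_mul_inv (inv_mem (h.conj_mem hx))
  rw [inv_inv, inv_inv] at this
  rw [← this, MulAut.conj_apply]
  congr 1
  group

/-- The action of a permutation of `Fin n` on natural numbers less than `n`. -/
def natMap {n : ℕ} (σ : Equiv.Perm (Fin n)) (m : ℕ) : ℕ := if h : m < n then σ ⟨m, h⟩ else m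

theorem natMap_val {n : ℕ} (σ : Equiv.Perm (Fin n)) (a : Fin n) : natMap σ a = σ a := by
  simp [natMap]

theorem natMap_inv_natMap {n : ℕ} (σ : Equiv.Perm (Fin n)) (m : ℕ) :
    natMap σ⁻¹ (natMap σ m) = m := by
  by_cases h : m < n
  · have := natMap_val σ ⟨m, h⟩
    simp only at this
    rw [this, natMap_val]
    simp
  · simp [natMap, h]

theorem MapsSimple.natMap_mem {n : ℕ} {σ : Equiv.Perm (Fin n)} {J J' : Set ℕ}
    (h : MapsSimple σ J J') (hJ : ∀ j ∈ J, j < n - 1) {m : ℕ} (hm : m ∈ J) :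
    natMap σ m ∈ J' ∧ natMap σ (m + 1) = natMap σ m + 1 := by
  obtain ⟨k, hk, h1, h2⟩ := h ⟨m, hJ m hm⟩ hm
  have e1 := natMap_val σ (lo ⟨m, hJ m hm⟩)
  have e2 := natMap_val σ (hi ⟨m, hJ m hm⟩)
  rw [h1, lo_val, lo_val] at e1
  rw [h2, hi_val, hi_val] at e2
  simp only at e1 e2
  rw [e1, e2]
  exact ⟨hk, rfl⟩

theorem MapsSimple.genNat_mul {n : ℕ} {σ : Equiv.Perm (Fin n)} {J J' : Set ℕ}
    (h : MapsSimple σ J J') (h' : MapsSimple σ⁻¹ J' J) (hJ : ∀ j ∈ J, j < n - 1) {m : ℕ}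
    (hm : m ∈ J) : genNat n m * T σ⁻¹ = T σ⁻¹ * genNat n (natMap σ m) := by
  obtain ⟨k, -, e, hk⟩ := h.conj_simpleRefl (i := ⟨m, hJ m hm⟩) hm
  have := h.T_mul_T_inv h' (simpleRefl_mem_young (i := ⟨m, hJ m hm⟩) hm)
  rw [hk, T_simpleRefl, T_simpleRefl, ← genNat_val, ← genNat_val, e, ← natMap_val] at this
  exact this

/-- The recursion for `L_m` runs inside one block, and `σ` carries blocks to blocks, preserving
successors and first indices. -/
theorem MapsSimple.jucysMurphy_mul {n : ℕ} {σ : Equiv.Perm (Fin n)} {J J' : Set ℕ}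
    (h : MapsSimple σ J J') (h' : MapsSimple σ⁻¹ J' J) (hJ : ∀ j ∈ J, j < n - 1)
    (hJ' : ∀ j ∈ J', j < n - 1) {m : ℕ} (hm : m ∈ J) :
    jucysMurphy (genNat n) J m * T σ⁻¹ = T σ⁻¹ * jucysMurphy (genNat n) J' (natMap σ m) := by
  -- If `m` begins a block, so does its image: a predecessor of the image in `J'` would be pulled
  -- back by `σ⁻¹` to a predecessor of `m` in `J`.
  have no_pred : (∀ i, i + 1 = m → i ∉ J) →
      jucysMurphy (genNat n) J' (natMap σ m) = genNat n (natMap σ m) := by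
    intro hp
    cases hk : natMap σ m with
    | zero => rfl
    | succ k =>
      refine jucysMurphy_succ_of_notMem fun hkJ => ?_
      obtain ⟨h1, h2⟩ := h'.natMap_mem hJ' hkJ
      rw [← hk, natMap_inv_natMap] at h2
      exact hp _ h2.symm h1
  have hgm := h.genNat_mul h' hJ hm
  induction m with
  | zero => rw [no_pred (by simp), jucysMurphy, hgm]
  | succ m ih =>
    by_cases hmJ : m ∈ J
    · obtain ⟨h1, h2⟩ := h.natMap_mem hJ hmJ
      have ih' : jucysMurphy (genNat n) J m * T σ⁻¹ =
          T σ⁻¹ * jucysMurphy (genNat n) J' (natMap σ m) := by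
        refine ih hmJ (fun hp => ?_) (h.genNat_mul h' hJ hmJ)
        cases hk : natMap σ m with
        | zero => rfl
        | succ k =>
          refine jucysMurphy_succ_of_notMem fun hkJ => ?_
          obtain ⟨h1, h2⟩ := h'.natMap_mem hJ' hkJ
          rw [← hk, natMap_inv_natMap] at h2
          exact hp _ h2.symm h1
      rw [h2] at hgm ⊢
      rw [jucysMurphy_succ_of_mem hmJ, jucysMurphy_succ_of_mem h1, add_mul, mul_add, hgm]
      congr 1
      rw [mul_assoc, hgm, ← mul_assoc, mul_assoc _ _ (T σ⁻¹), ih', ← mul_assoc, hgm]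
      simp only [mul_assoc]
    · rw [no_pred (fun i hi' => by obtain rfl : i = m := by omega
                                   exact hmJ), jucysMurphy_succ_of_notMem hmJ, hgm]

theorem list_prod_map_mul {R : Type*} [Monoid R] {ι : Type*} {l : List ι} {f g : ι → R} {t : R}
    (h : ∀ i ∈ l, f i * t = t * g i) : (l.map f).prod * t = t * (l.map g).prod := by
  induction l with
  | nil => simp
  | cons i l ih =>
    rw [List.map_cons, List.map_cons, List.prod_cons, List.prod_cons, mul_assoc,
      ih fun j hj => h j (by simp [hj]), ← mul_assoc, h i (by simp), mul_assoc]

/-- Moving `T σ⁻¹` across yields the factors of `J'` in the order imposed by `σ`; as they commute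
pairwise, they can be put in increasing order. -/
theorem MapsSimple.orderedProd_jucysMurphy_mul {n : ℕ} {σ : Equiv.Perm (Fin n)} {J J' : Set ℕ}
    (h : MapsSimple σ J J') (h' : MapsSimple σ⁻¹ J' J) (hJ : ∀ j ∈ J, j < n - 1)
    (hJ' : ∀ j ∈ J', j < n - 1) :
    orderedProd (jucysMurphy (genNat n) J) J (n - 1) * T σ⁻¹ =
      T σ⁻¹ * orderedProd (jucysMurphy (genNat n) J') J' (n - 1) := by
  classical
  rw [orderedProd, list_prod_map_mul (g := jucysMurphy (genNat n) J' ∘ natMap σ)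
    fun m hm => h.jucysMurphy_mul h' hJ hJ' (by simpa using (List.mem_filter.1 hm).2),
    orderedProd, ← List.map_map]
  congr 1
  have hinj : Function.Injective (natMap σ) :=
    Function.LeftInverse.injective (g := natMap σ⁻¹) (natMap_inv_natMap σ)
  have hperm : (((List.range (n - 1)).filter (· ∈ J)).map (natMap σ)).Perm
      ((List.range (n - 1)).filter (· ∈ J')) := by
    rw [List.perm_ext_iff_of_nodup ((List.nodup_range.filter _).map hinj)
      (List.nodup_range.filter _)]
    intro k
    simp only [List.mem_map, List.mem_filter, List.mem_range, decide_eq_true_eq]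
    constructor
    · rintro ⟨m, ⟨_, hm⟩, rfl⟩
      have := (h.natMap_mem hJ hm).1
      exact ⟨hJ' _ this, this⟩
    · rintro ⟨_, hk⟩
      have := (h'.natMap_mem hJ' hk).1
      have e := natMap_inv_natMap σ⁻¹ k
      rw [inv_inv] at e
      exact ⟨_, ⟨hJ _ this, this⟩, e⟩
  refine (hperm.map _).prod_eq' ?_
  have hmem : ∀ k ∈ ((List.range (n - 1)).filter (· ∈ J)).map (natMap σ), k ∈ J' := by
    intro k hk
    simpa using (List.mem_filter.1 (hperm.mem_iff.1 hk)).2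
  rw [List.pairwise_map]
  exact List.pairwise_of_forall_mem_list fun a ha b hb =>
    (isHeckeFamily_genNat hJ').commute_jucysMurphy_jucysMurphy (hmem a ha) (hmem b hb)

end HeckeNorm

theorem mainTheorem9 (n : ℕ) (α β : Composition n) (h : HeckeNorm.Conjugate α β) :
    HeckeNorm.b α = HeckeNorm.b β := by
  open HeckeNorm in
  obtain ⟨σ, hσ, hσ'⟩ := exists_mapsSimple h
  have hJ := lt_of_mem_simpleIndices α
  have hJ' := lt_of_mem_simpleIndices β
  rw [b, b, relNorm, relNorm, parabolic_eq_young, parabolic_eq_young, rightReps_top_young,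
    rightReps_top_young, eta_eq α (simpleIndices_subOne α), eta_eq β (simpleIndices_subOne β)]
  -- The intertwiner is `T σ⁻¹` and not `T σ`, because `σ⁻¹` is the element distinguished for the
  -- indices of `α`.
  refine sum_distinguished_conj (isUnit_T σ⁻¹) (MulAut.conj σ) (fun x => ⟨fun hx => ?_, hσ.conj_mem⟩)
    (fun x hx => hσ.T_mul_T_inv hσ' hx) (fun x hx => ?_)
    (hσ.orderedProd_jucysMurphy_mul hσ' hJ hJ')
  · have := hσ'.conj_mem hx
    simpa [mul_assoc] using this
  · exact commute_T_of_mem_young (fun j hj =>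
      ((isHeckeFamily_genNat hJ).commute_orderedProd_jucysMurphy hj (hJ j hj)).symm) hx
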